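/- Let $p$ be a prime, $r\ge 1$, and let $\mathbb Z_{p^r}$ be the ring of integers modulo $p^r$; for $0\le s\le r$ and $a\in\mathbb Z_{p^r}$ let $[a]_s\in\{0,\dots,p^s-1\}$ be the residue of $a$ modulo $p^s$. Entropies $H$ are in bits. A sequence $\mathbf x\in\mathcal X^n$ over a finite set $\mathcal X$ is $\epsilon$-typical with respect to a distribution $P$ on $\mathcal X$ if every $a\in\mathcal X$ satisfies $|\tfrac1n N(a|\mathbf x)-P(a)|\le \epsilon/|\mathcal X|$, where $N(a|\mathbf x)$ is the number of occurrences of $a$ in $\mathbf x$, and no $a$ with $P(a)=0$ occurs in $\mathbf x$. The set of these sequences is $A^{(n)}_\epsilon(P)$, also written $A^{(n)}_\epsilon(X)$ when $X\sim P$; similarly $A^{(n)}_\epsilon(X,Y)$ for the pair $(X,Y)$, viewed as one random variable with values in $\mathcal X\times\mathcal Y$. Let $(U,Q)$ be a pair of random variables with values in $\mathbb Z_{p^r}\times\mathcal Q$, where $\mathcal Q$ is finite and $P_Q(q)>0$ for all $q\in\mathcal Q$. Let $P_X$ be a distribution on $\mathbb Z_{p^r}$, let $P_{Y|X}(\cdot|x)$,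 $x\in\mathbb Z_{p^r}$, be distributions on a finite set $\mathcal Y$, and let $(X,Y)\sim P_XP_{Y|X}$. Let $c>0$. For each $n$ let the integers $k_q=k_q(n)$, $q\in\mathcal Q$, be $c\,n\,P_Q(q)$, rounded up or down if this is not an integer, and put $k_n=\sum_q k_q$. For $\epsilon>0$ let $\mathcal U_n=\prod_{q\in\mathcal Q}A^{(k_q)}_\epsilon(P_{U|Q=q})\subseteq\mathbb Z_{p^r}^{k_n}$. Given $\mathbf G\in\mathbb Z_{p^r}^{k_n\times n}$ and $\mathbf b\in\mathbb Z_{p^r}^n$, the codeword of $\mathbf u\in\mathcal U_n$ is $\mathbf c_n(\mathbf u)=\mathbf u\mathbf G+\mathbf b$, the quasi group code is $\mathcal C_n=\{\mathbf c_n(\mathbf u):\mathbf u\in\mathcal U_n\}$, and its rate is $R_n=\frac1n\log_2|\mathcal C_n|$. Then there is a function $\eta$, depending only on $P_{UQ}$, $P_X$, $P_{Y|X}$ and $c$, with $\eta(\epsilon)\to0$ as $\epsilon\downarrow0$, such that the following holds. For all $\epsilon>0$ and $\delta>0$ there is $N$ such that for all $n>N$ and all $\boldsymbol\theta\in\mathcal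 U_n$: if the pair $(\mathbf G,\mathbf b)$ is uniformly distributed over $\mathbb Z_{p^r}^{k_n\times n}\times\mathbb Z_{p^r}^n$, and if $\tilde{\mathbf Y}^n$ is a random sequence which, given $\mathbf c_n(\boldsymbol\theta)$, has the distribution $\prod_{i=1}^nP_{Y|X}(\tilde y_i|c_{n,i}(\boldsymbol\theta))$ and is conditionally independent of all other codewords, then $$P\Big\{R_n<\min_{0\le s\le r-1}\frac{H(U|Q)}{H(U|Q,[U]_s)}\big(\log_2p^{r-s}-H(X|Y,[X]_s)+\eta(\epsilon)\big)\ \text{ and }\ \exists\,\mathbf x\in\mathcal C_n:\ (\mathbf x,\tilde{\mathbf Y}^n)\in A^{(n)}_\epsilon(X,Y),\ \mathbf x\ne\mathbf c_n(\boldsymbol\theta)\Big\}<\delta ,$$ where the indices $s$ with $H(U|Q,[U]_s)=0$ are omitted from the minimum (which is $+\infty$ if none is left). In particular, if the bound on $R_n$ holds almost surely, then $$P\{\exists\,\mathbf x\in\mathcal C_n:\ (\mathbf x,\tilde{\mathbf Y}^n)\in A^{(n)}_\epsilon(X,Y),\ \mathbf x\ne\mathbf c_n(\boldsymbol\theta)\}<\delta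 .$$ -/

import Mathlib

open scoped BigOperators Topology

noncomputable section

namespace QGC

/-- The pair `(A, B)` where `A` has law `P` and, given `A = a`, `B` has law `K a`. -/
def pairLaw {α β : Type*} (P : PMF α) (K : α → PMF β) : PMF (α × β) :=
  P.bind fun a => (K a).map fun b => (a, b)

/-- Conditional entropy in bits, `H(f | g) = - ∑ P(f=a, g=b) log₂ P(f=a | g=b)`,
where the terms with `P(f=a, g=b) = 0` vanish. -/
def condEntropy {S α β : Type*} [Fintype α] [Fintype β] (P : PMF S) (f : S → α) (g : S → β) : ℝ :=
  - ∑ a, ∑ b, ((P.map fun t => (f t, g t)) (a, b)).toReal *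
      Real.logb 2 (((P.map fun t => (f t, g t)) (a, b)).toReal / ((P.map g) b).toReal)

/-- `[a]_s`: the representative in `{0, …, p^s - 1}` of `a ∈ ℤ/p^r` modulo `p^s ℤ/p^r`. -/
def trunc (p r s : ℕ) (a : ZMod (p ^ r)) : ZMod (p ^ r) := ((a.val % p ^ s : ℕ) : ZMod (p ^ r))

open Classical in
/-- The number of occurrences of the letter `a` in the sequence `x`. -/
def occ {α : Type*} {n : ℕ} (a : α) (x : Fin n → α) : ℕ :=
  (Finset.univ.filter fun i => x i = a).card

/-- The set of `ε`-typical sequences of length `n` with respect to `P`. -/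
def typicalSet {α : Type*} [Fintype α] (P : PMF α) (ε : ℝ) (n : ℕ) : Set (Fin n → α) :=
  {x | ∀ a, |(occ a x : ℝ) / n - (P a).toReal| ≤ ε / Fintype.card α ∧
    (P a = 0 → occ a x = 0)}

section Code

variable {p r : ℕ} [Fact p.Prime] {𝒬 : Type*}

/-- The index set `⨂_q A_ε^{(k_q)}(U_q)`, where `U_q` has law `PU q`. The coordinates of an
index vector are arranged in blocks, the block of `q` having length `k q`. -/
def indexSet (PU : 𝒬 → PMF (ZMod (p ^ r))) (ε : ℝ) (k : 𝒬 → ℕ) :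
    Set ((Σ q, Fin (k q)) → ZMod (p ^ r)) :=
  {u | ∀ q, (fun i => u ⟨q, i⟩) ∈ typicalSet (PU q) ε (k q)}

/-- The codeword `u G + b`. -/
def codeword [Fintype 𝒬] {n : ℕ} {k : 𝒬 → ℕ}
    (G : Matrix (Σ q, Fin (k q)) (Fin n) (ZMod (p ^ r))) (b : Fin n → ZMod (p ^ r))
    (u : (Σ q, Fin (k q)) → ZMod (p ^ r)) : Fin n → ZMod (p ^ r) :=
  Matrix.vecMul u G + b

/-- The quasi group code `{u G + b : u ∈ 𝒰}`. -/
def code [Fintype 𝒬] {n : ℕ} {k : 𝒬 → ℕ} (PU : 𝒬 → PMF (ZMod (p ^ r))) (ε : ℝ)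
    (G : Matrix (Σ q, Fin (k q)) (Fin n) (ZMod (p ^ r))) (b : Fin n → ZMod (p ^ r)) :
    Set (Fin n → ZMod (p ^ r)) :=
  codeword G b '' indexSet PU ε k

end Code

/-- The rate `(1/n) log₂ |C|` of a code of length `n`. -/
def rate {α : Type*} {n : ℕ} (C : Set (Fin n → α)) : ℝ := Real.logb 2 (C.ncard : ℝ) / n

/-- `Z` is a random variable, uniformly distributed over the finite type `α`. -/
def IsUniformRV {Ω α : Type*} [MeasurableSpace Ω] [Finite α] (μ : MeasureTheory.Measure Ω)
    (Z : Ω → α) : Prop :=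
  ∀ a, MeasurableSet (Z ⁻¹' {a}) ∧ μ.real (Z ⁻¹' {a}) = 1 / Nat.card α

/-- `Y` is a random sequence which, given the family `(c u)` for `u ∈ 𝒰`, is distributed as
`∏ i, W (· | (c u₀) i)`. That is: given `c u₀` it is the output of the memoryless channel `W`
for the input `c u₀`, and it is conditionally independent of the other `c u`. -/
def IsChannelOutput {Ω ι 𝒳 𝒴 : Type*} [MeasurableSpace Ω] {n : ℕ} (μ : MeasureTheory.Measure Ω)
    (W : 𝒳 → PMF 𝒴) (𝒰 : Set ι) (c : ι → Ω → (Fin n → 𝒳)) (u₀ : ι) (Y : Ω → (Fin n → 𝒴)) :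
    Prop :=
  (∀ y, MeasurableSet (Y ⁻¹' {y})) ∧
  ∀ (f : ι → (Fin n → 𝒳)) (y : Fin n → 𝒴),
    μ.real {ω | (∀ u ∈ 𝒰, c u ω = f u) ∧ Y ω = y} =
      μ.real {ω | ∀ u ∈ 𝒰, c u ω = f u} * ∏ i, (W (f u₀ i) (y i)).toReal

end QGC

end

noncomputable section

namespace QGC

/-! ### Conditional weights and entropies relative to a map. -/

section Weights

variable {α β : Type*} [Fintype α]

/-! Sort the pairs of distinct indices `u`, `v` by their level: the largest `s < r` such that they
agree modulo `p^s` in every coordinate. At level `s` the difference of the two codewords takes any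
given value with probability at most `p^{-(r-s)n}` (`card_vecMul_eq_mul_le`), and the two codewords
agree modulo `p^s`. Write `a_s = log₂ p^{r-s}`, `h_s = H(X|Y,[X]_s)`, `H_s = H(U|Q,[U]_s)`, `H =
H(U|Q)`. About `2^{ncH_s}` indices share the residues of `u₀`, and about `2^{nh_s}` sequences are
jointly typical with the output and have the residues of the true codeword. The union bound
therefore gives a sum of terms `2^{n(cH_s + h_s - a_s)}` (`real_exists_typical_le`), which is small
if `cH_s < a_s - h_s` at every level, with some margin.

The rate is that of the code itself, which collisions can make smaller than the index rate `cH`.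
Suppose the inequality fails at a level `t`. Then the rate bound at `t` is essentially at most `cH`,
so the rate condition makes the code exponentially smaller than its index set. By Cauchy-Schwarz
this requires many colliding pairs, and the expected number of these is small enough for Markov's
inequality (`real_ncard_code_le`); `le_sub_of_le_rateBound` compares the exponents. Thus one half of
the event is improbable in each case, and which half depends only on the given distributions, `c`
and `ε`. -/

open Classical in
/-- The probability that `g` takes the value `b`. -/
def fiberMass (P : PMF α) (g : α → β) (b : β) : ℝ := ∑ a with g a = b, (P a).toReal

/-- The conditional probability of `a` given the value `g a`. -/
def fiberWeight (P : PMF α) (g : α → β) (a : α) : ℝ := (P a).toReal / fiberMass P g (g a)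

/-- The entropy in bits of an outcome given the value of `g`. -/
def fiberEntropy (P : PMF α) (g : α → β) : ℝ :=
  -∑ a, (P a).toReal * Real.logb 2 (fiberWeight P g a)

/-- A bound for the deviation of the normalized log-likelihood on typical sequences. -/
def fiberDev (P : PMF α) (g : α → β) : ℝ := ∑ a, |Real.logb 2 (fiberWeight P g a)|

lemma sum_toReal (P : PMF α) : ∑ a, (P a).toReal = 1 := by
  rw [← ENNReal.toReal_sum (fun a _ => P.apply_ne_top a), ← tsum_fintype (L := .unconditional _), P.tsum_coe]
  rfl

lemma toReal_pos_of_ne {γ : Type*} {P : PMF γ} {a : γ} (h : P a ≠ 0) : 0 < (P a).toReal :=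
  ENNReal.toReal_pos h (P.apply_ne_top a)

lemma fiberMass_nonneg (P : PMF α) (g : α → β) (b : β) : 0 ≤ fiberMass P g b :=
  Finset.sum_nonneg fun _ _ => ENNReal.toReal_nonneg

lemma toReal_le_fiberMass (P : PMF α) (g : α → β) (a : α) : (P a).toReal ≤ fiberMass P g (g a) := by
  classical
  exact Finset.single_le_sum (f := fun a => (P a).toReal) (fun _ _ => ENNReal.toReal_nonneg)
    (by simp)

lemma fiberMass_le_one (P : PMF α) (g : α → β) (b : β) : fiberMass P g b ≤ 1 := by
  classical
  rw [← sum_toReal P]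
  exact Finset.sum_le_sum_of_subset_of_nonneg (Finset.filter_subset _ _)
    fun _ _ _ => ENNReal.toReal_nonneg

lemma fiberWeight_nonneg (P : PMF α) (g : α → β) (a : α) : 0 ≤ fiberWeight P g a :=
  div_nonneg ENNReal.toReal_nonneg (fiberMass_nonneg P g _)

lemma fiberWeight_le_one (P : PMF α) (g : α → β) (a : α) : fiberWeight P g a ≤ 1 :=
  div_le_one_of_le₀ (toReal_le_fiberMass P g a) (fiberMass_nonneg P g _)

lemma fiberWeight_pos {P : PMF α} (g : α → β) {a : α} (h : P a ≠ 0) : 0 < fiberWeight P g a :=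
  div_pos (toReal_pos_of_ne h) ((toReal_pos_of_ne h).trans_le (toReal_le_fiberMass P g a))

open Classical in
lemma sum_fiberWeight_le_one (P : PMF α) (g : α → β) (b : β) :
    ∑ a with g a = b, fiberWeight P g a ≤ 1 := by
  have : ∑ a with g a = b, fiberWeight P g a = fiberMass P g b / fiberMass P g b := by
    conv_rhs => rw [fiberMass, Finset.sum_div]
    refine Finset.sum_congr rfl fun a ha => ?_
    rw [fiberWeight, (Finset.mem_filter.1 ha).2, fiberMass]
  rw [this]
  exact div_self_le_one _

lemma fiberEntropy_nonneg (P : PMF α) (g : α → β) : 0 ≤ fiberEntropy P g := by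
  rw [fiberEntropy, ← Finset.sum_neg_distrib]
  refine Finset.sum_nonneg fun a _ => ?_
  rw [← mul_neg]
  refine mul_nonneg ENNReal.toReal_nonneg (neg_nonneg.2 ?_)
  exact Real.logb_nonpos (by norm_num) (fiberWeight_nonneg P g a) (fiberWeight_le_one P g a)

lemma fiberDev_nonneg (P : PMF α) (g : α → β) : 0 ≤ fiberDev P g :=
  Finset.sum_nonneg fun _ _ => abs_nonneg _

lemma fiberEntropy_le_const (P : PMF α) (g : α → β) :
    fiberEntropy P g ≤ fiberEntropy P fun _ => () := by
  rw [fiberEntropy, fiberEntropy, neg_le_neg_iff]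
  refine Finset.sum_le_sum fun a _ => ?_
  by_cases h : P a = 0
  · simp [h]
  refine mul_le_mul_of_nonneg_left ?_ ENNReal.toReal_nonneg
  refine Real.logb_le_logb_of_le (by norm_num) (fiberWeight_pos _ h) ?_
  have h1 : fiberMass P (fun _ => ()) () = 1 := by simp [fiberMass, sum_toReal]
  rw [fiberWeight, fiberWeight, h1]
  exact div_le_div_of_nonneg_left ENNReal.toReal_nonneg
    ((toReal_pos_of_ne h).trans_le (toReal_le_fiberMass P g a)) (fiberMass_le_one P g _)

/-- Zero entropy makes every summand vanish, whereas two possible outcomes in one fibre would give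
weights strictly below 1. This is why levels of zero conditional entropy can be discarded. -/
lemma eq_of_fiberEntropy_eq_zero {P : PMF α} {g : α → β} (h : fiberEntropy P g = 0) {a a' : α}
    (ha : P a ≠ 0) (ha' : P a' ≠ 0) (hg : g a = g a') : a = a' := by
  classical
  by_contra hne
  rw [fiberEntropy, neg_eq_zero, Finset.sum_eq_zero_iff_of_nonpos] at h
  · have h2 := h a (Finset.mem_univ _)
    have hlt : fiberWeight P g a < 1 := by
      refine (div_lt_one ((toReal_pos_of_ne ha).trans_le (toReal_le_fiberMass P g a))).2 ?_
      calc (P a).toReal < (P a).toReal + (P a').toReal :=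
            lt_add_of_pos_right _ (toReal_pos_of_ne ha')
        _ = ∑ t ∈ ({a, a'} : Finset α), (P t).toReal := 
            (Finset.sum_pair (f := fun t => (P t).toReal) hne).symm
        _ ≤ fiberMass P g (g a) := by
            refine Finset.sum_le_sum_of_subset_of_nonneg ?_ fun _ _ _ => ENNReal.toReal_nonneg
            intro t ht
            rcases Finset.mem_insert.1 ht with rfl | ht
            · simp
            · rw [Finset.mem_singleton.1 ht]; simp [hg]
    have := mul_neg_of_pos_of_neg (toReal_pos_of_ne ha)
      (Real.logb_neg (b := 2) (by norm_num) (fiberWeight_pos g ha) hlt)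
    linarith
  · intro t _
    exact mul_nonpos_of_nonneg_of_nonpos ENNReal.toReal_nonneg
      (Real.logb_nonpos (by norm_num) (fiberWeight_nonneg P g t) (fiberWeight_le_one P g t))

end Weights

/-! ### Counting typical sequences. -/

section Typical

variable {α β : Type*} [Fintype α]

lemma ne_zero_of_mem_typicalSet {P : PMF α} {ε : ℝ} {n : ℕ} {x : Fin n → α}
    (hx : x ∈ typicalSet P ε n) (i : Fin n) : P (x i) ≠ 0 := by
  classical
  intro h
  have := (hx (x i)).2 h
  rw [occ, Finset.card_eq_zero] at this
  exact Finset.notMem_empty i (this ▸ by simp)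

lemma sum_comp_eq_sum_occ {n : ℕ} (x : Fin n → α) (f : α → ℝ) :
    ∑ i, f (x i) = ∑ a, (occ a x : ℝ) * f a := by
  classical
  rw [← Finset.sum_fiberwise Finset.univ x]
  refine Finset.sum_congr rfl fun a _ => ?_
  rw [Finset.sum_congr rfl (g := fun _ => f a)]
  · rw [Finset.sum_const, nsmul_eq_mul, occ]
  · intro i hi
    rw [(Finset.mem_filter.1 hi).2]

lemma abs_sum_logb_add_le (P : PMF α) (g : α → β) {ε : ℝ} (hε : 0 ≤ ε) {n : ℕ} {x : Fin n → α}
    (hx : x ∈ typicalSet P ε n) :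
    |∑ i, Real.logb 2 (fiberWeight P g (x i)) + n * fiberEntropy P g| ≤ n * (ε * fiberDev P g) := by
  classical
  rcases Nat.eq_zero_or_pos n with rfl | hn
  · simp
  have hn' : (0 : ℝ) < n := by exact_mod_cast hn
  have : ∑ i, Real.logb 2 (fiberWeight P g (x i)) + n * fiberEntropy P g =
      ∑ a, ((occ a x : ℝ) / n - (P a).toReal) * n * Real.logb 2 (fiberWeight P g a) := by
    rw [sum_comp_eq_sum_occ x fun a => Real.logb 2 (fiberWeight P g a), fiberEntropy, mul_neg,
      ← sub_eq_add_neg, Finset.mul_sum, ← Finset.sum_sub_distrib]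
    refine Finset.sum_congr rfl fun a _ => ?_
    field_simp
  rw [this, fiberDev, Finset.mul_sum, Finset.mul_sum]
  refine (Finset.abs_sum_le_sum_abs _ _).trans (Finset.sum_le_sum fun a _ => ?_)
  rw [abs_mul, abs_mul, abs_of_pos hn']
  have h1 : ε / Fintype.card α ≤ ε := by
    have : Nonempty α := ⟨a⟩
    exact div_le_self hε (by exact_mod_cast Fintype.card_pos)
  have h2 := (hx a).1.trans h1
  calc _ ≤ ε * n * |Real.logb 2 (fiberWeight P g a)| := by gcongr
    _ = _ := by ring

lemma prod_fiberWeight_eq (P : PMF α) (g : α → β) {ε : ℝ} {n : ℕ} {x : Fin n → α}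
    (hx : x ∈ typicalSet P ε n) :
    ∏ i, fiberWeight P g (x i) = (2 : ℝ) ^ ∑ i, Real.logb 2 (fiberWeight P g (x i)) := by
  rw [Real.rpow_sum_of_pos (by norm_num)]
  exact Finset.prod_congr rfl fun i _ =>
    (Real.rpow_logb (by norm_num) (by norm_num)
      (fiberWeight_pos g (ne_zero_of_mem_typicalSet hx i))).symm

-- The product weights of all sequences over `v` sum to at most 1, and each typical one weighs at
-- least `2^{-n(H + εD)}`. No typicality of `v` is needed.
open Classical in
lemma card_typical_fiber_le (P : PMF α) (g : α → β) {ε : ℝ} (hε : 0 ≤ ε) {n : ℕ} (v : Fin n → β) :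
    ((Finset.univ.filter fun x : Fin n → α => x ∈ typicalSet P ε n ∧ ∀ i, g (x i) = v i).card : ℝ)
      ≤ (2 : ℝ) ^ (n * (fiberEntropy P g + ε * fiberDev P g)) := by
  set S := Finset.univ.filter fun x : Fin n → α => x ∈ typicalSet P ε n ∧ ∀ i, g (x i) = v i
  have h1 : (S.card : ℝ) * (2 : ℝ) ^ (-(n * (fiberEntropy P g + ε * fiberDev P g))) ≤ 1 := by
    calc _ = ∑ x ∈ S, (2 : ℝ) ^ (-(n * (fiberEntropy P g + ε * fiberDev P g))) := by
          rw [Finset.sum_const, nsmul_eq_mul]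
      _ ≤ ∑ x ∈ S, ∏ i, fiberWeight P g (x i) := by
          refine Finset.sum_le_sum fun x hx => ?_
          have hx := (Finset.mem_filter.1 hx).2.1
          rw [prod_fiberWeight_eq P g hx]
          refine Real.rpow_le_rpow_of_exponent_le (by norm_num) ?_
          have := (abs_le.1 (abs_sum_logb_add_le P g hε hx)).1
          linarith
      _ ≤ ∑ x ∈ Fintype.piFinset fun i => Finset.univ.filter fun a => g a = v i,
            ∏ i, fiberWeight P g (x i) := by
          refine Finset.sum_le_sum_of_subset_of_nonneg ?_ fun _ _ _ =>
            Finset.prod_nonneg fun _ _ => fiberWeight_nonneg _ _ _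
          intro x hx
          simpa [Fintype.mem_piFinset] using (Finset.mem_filter.1 hx).2.2
      _ = ∏ i, ∑ a with g a = v i, fiberWeight P g a :=
          (Finset.prod_univ_sum _ _).symm
      _ ≤ 1 := Finset.prod_le_one
          (fun _ _ => Finset.sum_nonneg fun _ _ => fiberWeight_nonneg _ _ _)
          (fun i _ => sum_fiberWeight_le_one P g (v i))
  rwa [Real.rpow_neg (by norm_num), ← div_eq_mul_inv, div_le_one (by positivity)] at h1

lemma sum_pi_succ {n : ℕ} (F : (Fin (n + 1) → α) → ℝ) :
    ∑ x, F x = ∑ a, ∑ x : Fin n → α, F (Fin.cons a x) := by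
  rw [← (Fin.consEquiv fun _ : Fin (n + 1) => α).sum_comp, Fintype.sum_prod_type]
  rfl

lemma sum_prod_eq_one (P : PMF α) (n : ℕ) :
    ∑ x : Fin n → α, ∏ i, (P (x i)).toReal = 1 := by
  classical
  have := Finset.prod_univ_sum (fun _ : Fin n => (Finset.univ : Finset α)) fun _ a => (P a).toReal
  rw [Fintype.piFinset_univ] at this
  rw [← this]
  simp [sum_toReal]

lemma sum_prod_mul_sum (P : PMF α) {f : α → ℝ} (hf : ∑ a, (P a).toReal * f a = 0) (n : ℕ) :
    ∑ x : Fin n → α, (∏ i, (P (x i)).toReal) * ∑ i, f (x i) = 0 := by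
  induction n with
  | zero => simp
  | succ n ih =>
    rw [sum_pi_succ]
    simp only [Fin.prod_univ_succ, Fin.sum_univ_succ, Fin.cons_zero, Fin.cons_succ]
    have (a : α) : ∑ x : Fin n → α, ((P a).toReal * ∏ i, (P (x i)).toReal) * (f a + ∑ i, f (x i)) =
        (P a).toReal * f a := by
      have : ∀ x : Fin n → α, ((P a).toReal * ∏ i, (P (x i)).toReal) * (f a + ∑ i, f (x i)) =
          (P a).toReal * f a * (∏ i, (P (x i)).toReal) +
            (P a).toReal * ((∏ i, (P (x i)).toReal) * ∑ i, f (x i)) := fun x => by ring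
      simp only [this, Finset.sum_add_distrib, ← Finset.mul_sum, ih, sum_prod_eq_one]
      ring
    simp only [this, hf]

lemma sum_prod_mul_sum_sq (P : PMF α) {f : α → ℝ} (hf : ∑ a, (P a).toReal * f a = 0) (n : ℕ) :
    ∑ x : Fin n → α, (∏ i, (P (x i)).toReal) * (∑ i, f (x i)) ^ 2 =
      n * ∑ a, (P a).toReal * f a ^ 2 := by
  induction n with
  | zero => simp
  | succ n ih =>
    rw [sum_pi_succ]
    simp only [Fin.prod_univ_succ, Fin.sum_univ_succ, Fin.cons_zero, Fin.cons_succ]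
    have (a : α) : ∑ x : Fin n → α,
        ((P a).toReal * ∏ i, (P (x i)).toReal) * (f a + ∑ i, f (x i)) ^ 2 =
        (P a).toReal * f a ^ 2 + (P a).toReal * (n * ∑ a, (P a).toReal * f a ^ 2) := by
      have : ∀ x : Fin n → α, ((P a).toReal * ∏ i, (P (x i)).toReal) * (f a + ∑ i, f (x i)) ^ 2 =
          (P a).toReal * f a ^ 2 * (∏ i, (P (x i)).toReal) +
          2 * (P a).toReal * f a * ((∏ i, (P (x i)).toReal) * ∑ i, f (x i)) +
            (P a).toReal * ((∏ i, (P (x i)).toReal) * (∑ i, f (x i)) ^ 2) := fun x => by ring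
      simp only [this, Finset.sum_add_distrib, ← Finset.mul_sum, ih, sum_prod_eq_one,
        sum_prod_mul_sum P hf]
      ring
    simp only [this, Finset.sum_add_distrib, ← Finset.sum_mul, sum_toReal]
    push_cast
    ring

lemma sum_prod_mul_occ_sub_sq_le (P : PMF α) (a : α) (n : ℕ) :
    ∑ x : Fin n → α, (∏ i, (P (x i)).toReal) * ((occ a x : ℝ) - n * (P a).toReal) ^ 2 ≤ n := by
  classical
  set f : α → ℝ := fun t => (if t = a then 1 else 0) - (P a).toReal with hfdef
  have hf : ∑ t, (P t).toReal * f t = 0 := by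
    simp [hfdef, mul_sub, Finset.sum_sub_distrib, ← Finset.sum_mul, sum_toReal]
  have hocc (x : Fin n → α) : (occ a x : ℝ) - n * (P a).toReal = ∑ i, f (x i) := by
    simp [hfdef, Finset.sum_sub_distrib, occ]
  simp only [hocc]
  rw [sum_prod_mul_sum_sq P hf]
  have h1 : (P a).toReal ≤ 1 := by
    simpa using ENNReal.toReal_mono ENNReal.one_ne_top (P.coe_le_one a)
  have h0 : 0 ≤ (P a).toReal := ENNReal.toReal_nonneg
  refine mul_le_of_le_one_right (Nat.cast_nonneg n) ?_
  rw [← sum_toReal P]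
  refine Finset.sum_le_sum fun t _ => mul_le_of_le_one_right ENNReal.toReal_nonneg ?_
  rw [sq_le_one_iff_abs_le_one, abs_le]
  simp only [hfdef]
  split_ifs <;> constructor <;> linarith

-- Chebyshev's inequality for each letter count, then a union bound: `|α|` letters at `|α|² / (n
-- ε²)` each, whence the cube in the threshold for `n`.
open Classical in
lemma half_le_sum_typical (P : PMF α) {ε : ℝ} (hε : 0 < ε) {n : ℕ}
    (hn : 2 * (Fintype.card α : ℝ) ^ 3 / ε ^ 2 ≤ n) (hn0 : 0 < n) :
    1 / 2 ≤ ∑ x : Fin n → α with x ∈ typicalSet P ε n, ∏ i, (P (x i)).toReal := by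
  have hn' : (0 : ℝ) < n := by exact_mod_cast hn0
  obtain ⟨a₀, -⟩ := P.support_nonempty
  have : Nonempty α := ⟨a₀⟩
  have hcard : (0 : ℝ) < Fintype.card α := by exact_mod_cast Fintype.card_pos
  set τ : ℝ := n * (ε / Fintype.card α) with hτ
  have hτ0 : 0 < τ := by positivity
  have hw (x : Fin n → α) : 0 ≤ ∏ i, (P (x i)).toReal :=
    Finset.prod_nonneg fun _ _ => ENNReal.toReal_nonneg
  have hbad : ∑ x : Fin n → α with x ∉ typicalSet P ε n, ∏ i, (P (x i)).toReal ≤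
      ∑ x : Fin n → α, ∑ a, (∏ i, (P (x i)).toReal) *
        ((occ a x : ℝ) - n * (P a).toReal) ^ 2 / τ ^ 2 := by
    rw [Finset.sum_filter]
    refine Finset.sum_le_sum fun x _ => ?_
    have hnn (a : α) : 0 ≤ (∏ i, (P (x i)).toReal) *
        ((occ a x : ℝ) - n * (P a).toReal) ^ 2 / τ ^ 2 := by
      have := hw x
      positivity
    split_ifs with hx
    · exact Finset.sum_nonneg fun a _ => hnn a
    -- A sequence containing an impossible letter has mass zero, so the second clause of typicality
    -- costs nothing.
    · by_cases hz : ∃ i, P (x i) = 0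
      · obtain ⟨i, hi⟩ := hz
        rw [Finset.prod_eq_zero (Finset.mem_univ i) (by simp [hi])]
        simp
      · push Not at hz
        have : ∃ a, ε / Fintype.card α < |(occ a x : ℝ) / n - (P a).toReal| := by
          by_contra! hcon
          refine hx fun a => ⟨hcon a, fun ha => ?_⟩
          rw [occ, Finset.card_eq_zero, Finset.filter_eq_empty_iff]
          intro i _ hi
          exact hz i (hi ▸ ha)
        obtain ⟨a, ha⟩ := this
        refine le_trans ?_ (Finset.single_le_sum (fun a _ => hnn a) (Finset.mem_univ a))
        rw [mul_div_assoc]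
        refine le_mul_of_one_le_right (hw x) ((one_le_div (by positivity)).2 ?_)
        rw [← sq_abs ((occ a x : ℝ) - _)]
        refine pow_le_pow_left₀ hτ0.le ?_ 2
        have : (occ a x : ℝ) - n * (P a).toReal = n * ((occ a x : ℝ) / n - (P a).toReal) := by
          field_simp
        rw [this, abs_mul, abs_of_pos hn']
        exact mul_le_mul_of_nonneg_left ha.le hn'.le
  have hbad2 : ∑ x : Fin n → α with x ∉ typicalSet P ε n, ∏ i, (P (x i)).toReal ≤ 1 / 2 := by
    refine hbad.trans ?_
    rw [Finset.sum_comm]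
    calc _ ≤ ∑ a : α, (n : ℝ) / τ ^ 2 := by
          refine Finset.sum_le_sum fun a _ => ?_
          rw [← Finset.sum_div]
          gcongr
          exact sum_prod_mul_occ_sub_sq_le P a n
      _ = Fintype.card α * (n / τ ^ 2) := by simp
      _ ≤ 1 / 2 := by
          rw [div_le_iff₀ (by positivity)] at hn
          rw [hτ]
          field_simp
          linarith
  have := Finset.sum_filter_add_sum_filter_not Finset.univ (fun x => x ∈ typicalSet P ε n)
    fun x : Fin n → α => ∏ i, (P (x i)).toReal
  rw [sum_prod_eq_one] at this
  linarith

open Classical in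
lemma le_card_typical (P : PMF α) {ε : ℝ} (hε : 0 < ε) {n : ℕ}
    (hn : 2 * (Fintype.card α : ℝ) ^ 3 / ε ^ 2 ≤ n) (hn0 : 0 < n) :
    1 / 2 * (2 : ℝ) ^ (n * (fiberEntropy P (fun _ => ()) - ε * fiberDev P (fun _ => ()))) ≤
      ((Finset.univ.filter fun x : Fin n → α => x ∈ typicalSet P ε n).card : ℝ) := by
  set H := fiberEntropy P (fun _ => ())
  set D := fiberDev P (fun _ => ())
  have h1 : fiberMass P (fun _ => ()) () = 1 := by simp [fiberMass, sum_toReal]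
  have key : 1 / 2 ≤ ((Finset.univ.filter fun x : Fin n → α => x ∈ typicalSet P ε n).card : ℝ) *
      (2 : ℝ) ^ (-(n * (H - ε * D))) := by
    refine (half_le_sum_typical P hε hn hn0).trans ?_
    rw [← nsmul_eq_mul, ← Finset.sum_const]
    refine Finset.sum_le_sum fun x hx => ?_
    have hx := (Finset.mem_filter.1 hx).2
    have : ∏ i, (P (x i)).toReal = ∏ i, fiberWeight P (fun _ => ()) (x i) := by
      simp [fiberWeight, h1]
    rw [this, prod_fiberWeight_eq P _ hx]
    refine Real.rpow_le_rpow_of_exponent_le (by norm_num) ?_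
    have := (abs_le.1 (abs_sum_logb_add_le P (fun _ => ()) hε.le hx)).2
    linarith
  rwa [Real.rpow_neg (by norm_num), ← div_eq_mul_inv, le_div_iff₀ (by positivity)] at key

end Typical

/-! ### Conditional entropies expressed through fibre entropies. -/

section Entropy

variable {S α β γ 𝒬 : Type*}

lemma toReal_map_apply [Fintype S] (P : PMF S) (h : S → α) (b : α) :
    ((P.map h) b).toReal = fiberMass P h b := by
  classical
  rw [PMF.map_apply, tsum_fintype, ENNReal.toReal_sum, fiberMass, Finset.sum_filter]
  · refine Finset.sum_congr rfl fun t _ => ?_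
    by_cases ht : h t = b
    · simp [ht]
    · simp [ht, Ne.symm ht]
  · intro t _
    split_ifs
    · exact P.apply_ne_top t
    · simp

/-- Since `(f, g)` determines the outcome, its law is `P` transported along an injection; pairs
outside the range contribute nothing. -/
lemma condEntropy_eq_fiberEntropy [Fintype S] [Fintype α] [Fintype β] (P : PMF S) (f : S → α)
    (g : S → β) (hfg : Function.Injective fun t => (f t, g t)) :
    condEntropy P f g = fiberEntropy P g := by
  classical
  simp only [condEntropy, fiberEntropy, toReal_map_apply]
  rw [← Fintype.sum_prod_type' (f := fun a b => fiberMass P (fun t => (f t, g t)) (a, b) *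
    Real.logb 2 (fiberMass P (fun t => (f t, g t)) (a, b) / fiberMass P g b)),
    ← Finset.sum_fiberwise Finset.univ fun t => (f t, g t)]
  congr 1
  refine Finset.sum_congr rfl fun z _ => ?_
  rw [Prod.mk.eta]
  conv_lhs => enter [1]; rw [fiberMass]
  rw [Finset.sum_mul]
  refine Finset.sum_congr (by ext; simp) fun t ht => ?_
  have ht : (f t, g t) = z := (Finset.mem_filter.1 ht).2
  have hm : fiberMass P (fun t => (f t, g t)) z = (P t).toReal := by
    rw [fiberMass, Finset.sum_filter, Finset.sum_eq_single t]
    · simp [ht]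
    · intro t' _ hne
      exact if_neg fun h => hne (hfg (h.trans ht.symm))
    · simp
  rw [hm, fiberWeight, ← ht]

lemma pairLaw_apply (P : PMF 𝒬) (K : 𝒬 → PMF α) (q : 𝒬) (a : α) :
    pairLaw P K (q, a) = P q * K q a := by
  classical
  rw [pairLaw, PMF.bind_apply, tsum_eq_single q]
  · rw [PMF.map_apply, tsum_eq_single a]
    · simp
    · intro b hb
      simp [hb.symm]
  · intro q' hq'
    simp [PMF.map_apply, hq'.symm]

/-- The hypothesis on `g` confines each fibre to a single `q`, so the factor `P q` cancels from the
conditional weights. -/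
lemma fiberEntropy_pairLaw [Fintype 𝒬] [Fintype α] (P : PMF 𝒬) (hP : ∀ q, 0 < P q)
    (K : 𝒬 → PMF α) (g : 𝒬 × α → β) (g' : α → γ)
    (hg : ∀ q a q' a', g (q, a) = g (q', a') ↔ q = q' ∧ g' a = g' a') :
    fiberEntropy (pairLaw P K) g = ∑ q, (P q).toReal * fiberEntropy (K q) g' := by
  classical
  have hmass (q : 𝒬) (a : α) : fiberMass (pairLaw P K) g (g (q, a)) =
      (P q).toReal * fiberMass (K q) g' (g' a) := by
    rw [fiberMass, fiberMass, Finset.sum_filter, Fintype.sum_prod_type, Finset.sum_eq_single q,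
      Finset.mul_sum, Finset.sum_filter]
    · simp [hg, pairLaw_apply]
    · intro q' _ hne
      simp [hg, hne]
    · simp
  have hw (q : 𝒬) (a : α) : fiberWeight (pairLaw P K) g (q, a) = fiberWeight (K q) g' a := by
    rw [fiberWeight, hmass, pairLaw_apply, ENNReal.toReal_mul, fiberWeight,
      mul_div_mul_left _ _ (toReal_pos_of_ne (hP q).ne').ne']
  simp only [fiberEntropy, Fintype.sum_prod_type, hw, pairLaw_apply, ENNReal.toReal_mul, mul_neg,
    Finset.sum_neg_distrib, Finset.mul_sum, mul_assoc]

lemma condEntropy_pairLaw_fiber [Fintype 𝒬] [Fintype α] [Fintype γ] (P : PMF 𝒬)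
    (hP : ∀ q, 0 < P q) (K : 𝒬 → PMF α) (g : α → γ) :
    condEntropy (pairLaw P K) (fun t => t.2) (fun t => (t.1, g t.2)) =
      ∑ q, (P q).toReal * fiberEntropy (K q) g := by
  rw [condEntropy_eq_fiberEntropy, fiberEntropy_pairLaw P hP K _ g]
  · simp
  · rintro ⟨q, a⟩ ⟨q', a'⟩ h
    simp_all

lemma condEntropy_pairLaw_const [Fintype 𝒬] [Fintype α] (P : PMF 𝒬)
    (hP : ∀ q, 0 < P q) (K : 𝒬 → PMF α) :
    condEntropy (pairLaw P K) (fun t => t.2) (fun t => t.1) =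
      ∑ q, (P q).toReal * fiberEntropy (K q) (fun _ => ()) := by
  rw [condEntropy_eq_fiberEntropy, fiberEntropy_pairLaw P hP K _ fun _ => ()]
  · simp
  · rintro ⟨q, a⟩ ⟨q', a'⟩ h
    simp_all

end Entropy

/-! ### Residues modulo powers of `p` and linear equations over `ZMod (p ^ r)`. -/

section Truncation

variable {p r : ℕ} [Fact p.Prime]

lemma trunc_eq_trunc_iff {t : ℕ} (ht : t ≤ r) (a b : ZMod (p ^ r)) :
    trunc p r t a = trunc p r t b ↔ (p : ZMod (p ^ r)) ^ t ∣ a - b := by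
  have hp : 0 < p := (Fact.out : p.Prime).pos
  have hlt (m : ℕ) : m % p ^ t < p ^ r :=
    (Nat.mod_lt _ (pow_pos hp t)).trans_le (Nat.pow_le_pow_right hp ht)
  have h1 : trunc p r t a = trunc p r t b ↔ a.val ≡ b.val [MOD p ^ t] := by
    rw [trunc, trunc, ZMod.natCast_eq_natCast_iff', Nat.mod_eq_of_lt (hlt _),
      Nat.mod_eq_of_lt (hlt _)]
    rfl
  rw [h1]
  constructor
  · intro h
    obtain ⟨z, hz⟩ := (Nat.modEq_iff_dvd.1 h.symm)
    refine ⟨(z : ZMod (p ^ r)), ?_⟩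
    have := congrArg (Int.cast : ℤ → ZMod (p ^ r)) hz
    simpa using this
  · rintro ⟨z, hz⟩
    have hd : p ^ t ∣ p ^ r := pow_dvd_pow p ht
    have h2 := congrArg (ZMod.castHom hd (ZMod (p ^ t))) hz
    rw [map_mul, map_pow, map_natCast, ← Nat.cast_pow, ZMod.natCast_self, zero_mul, map_sub,
      sub_eq_zero] at h2
    rw [← ZMod.natCast_eq_natCast_iff]
    simpa [ZMod.natCast_val] using h2

/-- If every agreement modulo `p^s` lifted to one modulo `p^{s+1}`, induction would reach `p^r = 0`
and force equality. -/
lemma exists_level {ι : Type*} {u v : ι → ZMod (p ^ r)} (h : u ≠ v) :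
    ∃ s < r, (∀ i, trunc p r s (u i) = trunc p r s (v i)) ∧
      ∃ j, ¬ (p : ZMod (p ^ r)) ^ (s + 1) ∣ (u - v) j := by
  by_contra! hcon
  have key : ∀ s ≤ r, ∀ i, trunc p r s (u i) = trunc p r s (v i) := by
    intro s
    induction s with
    | zero => intro _ i; simp [trunc_eq_trunc_iff]
    | succ s ih =>
      intro hs i
      exact (trunc_eq_trunc_iff hs _ _).2 (hcon s hs (ih (by omega)) i)
  refine h (funext fun i => ?_)
  have := (trunc_eq_trunc_iff le_rfl _ _).1 (key r le_rfl i)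
  rw [← Nat.cast_pow, ZMod.natCast_self, zero_dvd_iff, sub_eq_zero] at this
  exact this

/-- The `p`-adic valuation of `v` is at most `s`, so `p^r` dividing `v (w' - w)` leaves at least
`p^{r-s}` dividing `w' - w`. -/
lemma natCast_mul_left_cancel {s : ℕ} (hs : s < r) {v : ZMod (p ^ r)}
    (hv : ¬ (p : ZMod (p ^ r)) ^ (s + 1) ∣ v) {w w' : ℕ} (hw : w < p ^ (r - s))
    (hw' : w' < p ^ (r - s)) (h : v * w = v * w') : w = w' := by
  wlog hle : w ≤ w' generalizing w w'
  · exact (this hw' hw h.symm (le_of_not_ge hle)).symm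
  by_contra hne
  have hD : w' - w ≠ 0 := by omega
  have hvv : v.val ≠ 0 := by
    intro h0
    rw [(ZMod.val_eq_zero v).1 h0] at hv
    exact hv (dvd_zero _)
  have h1 : p ^ r ∣ v.val * (w' - w) := by
    rw [← ZMod.natCast_eq_zero_iff, Nat.cast_mul, Nat.cast_sub hle, ZMod.natCast_val,
      ZMod.cast_id', id, mul_sub, h, sub_self]
  have h2 : ¬ p ^ (s + 1) ∣ v.val := by
    rintro ⟨z, hz⟩
    refine hv ⟨z, ?_⟩
    rw [← ZMod.natCast_zmod_val v, hz]
    push_cast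
    rfl
  have h3 : ¬ p ^ (r - s) ∣ w' - w := fun hd => by
    have := Nat.le_of_dvd (Nat.pos_of_ne_zero hD) hd
    omega
  rw [padicValNat_dvd_iff_le hvv] at h2
  rw [padicValNat_dvd_iff_le hD] at h3
  rw [padicValNat_dvd_iff_le (mul_ne_zero hvv hD), padicValNat.mul hvv hD] at h1
  omega

/-- Adding `w` to row `j` of a solution shifts `v G` by `v j * w`. These shifts differ for different
`w` with entries below `p^{r-s}`, so the `(p^{r-s})^n` translates of the solution set are disjoint.
-/
lemma card_vecMul_eq_mul_le {ι : Type*} [Fintype ι] [DecidableEq ι] {n s : ℕ} (hs : s < r)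
    {v : ι → ZMod (p ^ r)} {j : ι} (hj : ¬ (p : ZMod (p ^ r)) ^ (s + 1) ∣ v j)
    (d : Fin n → ZMod (p ^ r)) :
    (Finset.univ.filter fun G : Matrix ι (Fin n) (ZMod (p ^ r)) => Matrix.vecMul v G = d).card *
      (p ^ (r - s)) ^ n ≤ Fintype.card (Matrix ι (Fin n) (ZMod (p ^ r))) := by
  set S := Finset.univ.filter fun G : Matrix ι (Fin n) (ZMod (p ^ r)) => Matrix.vecMul v G = d
    with hS
  let E : (Fin n → Fin (p ^ (r - s))) → Matrix ι (Fin n) (ZMod (p ^ r)) := fun w =>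
    Matrix.of fun i l => if i = j then ((w l : ℕ) : ZMod (p ^ r)) else 0
  have hE (w : Fin n → Fin (p ^ (r - s))) (l : Fin n) :
      Matrix.vecMul v (E w) l = v j * ((w l : ℕ) : ZMod (p ^ r)) := by
    simp [E, Matrix.vecMul, dotProduct]
  have hinj : Function.Injective
      fun z : S × (Fin n → Fin (p ^ (r - s))) => (z.1 : Matrix ι (Fin n) (ZMod (p ^ r))) + E z.2 := by
    rintro ⟨⟨G, hG⟩, w⟩ ⟨⟨G', hG'⟩, w'⟩ h
    have hG := (Finset.mem_filter.1 hG).2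
    have hG' := (Finset.mem_filter.1 hG').2
    dsimp only at h
    have hw : w = w' := by
      funext l
      have := congrArg (fun M => Matrix.vecMul v M l) h
      simp only [Matrix.vecMul_add, Pi.add_apply, hG, hG', hE, add_right_inj] at this
      exact Fin.ext (natCast_mul_left_cancel hs hj (w l).2 (w' l).2 this)
    subst hw
    simpa using h
  have := Fintype.card_le_of_injective _ hinj
  simpa using this

end Truncation

/-! ### Uniform variables and channel outputs. -/

section Probability

open MeasureTheory

variable {Ω α : Type*} [MeasurableSpace Ω] {μ : Measure Ω}

lemma IsUniformRV.measurableSet [Fintype α] {Z : Ω → α} (hZ : IsUniformRV μ Z) (T : Set α) :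
    MeasurableSet {ω | Z ω ∈ T} := by
  have : {ω | Z ω ∈ T} = ⋃ a ∈ T, Z ⁻¹' {a} := by ext; simp
  rw [this]
  exact MeasurableSet.biUnion (Set.to_countable T) fun a _ => (hZ a).1

lemma IsUniformRV.real_eq [IsProbabilityMeasure μ] [Fintype α] {Z : Ω → α}
    (hZ : IsUniformRV μ Z) (q : α → Prop) [DecidablePred q] :
    μ.real {ω | q (Z ω)} = ((Finset.univ.filter q).card : ℝ) / Fintype.card α := by
  have : {ω | q (Z ω)} = ⋃ a ∈ Finset.univ.filter q, Z ⁻¹' {a} := by ext; simp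
  rw [this, measureReal_biUnion_finset]
  · simp [(hZ _).2, Nat.card_eq_fintype_card, div_eq_mul_inv]
  · intro a _ b _ hab
    exact Disjoint.preimage _ (by simpa using hab)
  · exact fun a _ => (hZ a).1

/-- The channel hypothesis fixes the entire codebook. Summing over all codebooks with the two
prescribed codewords keeps the channel factor, which sees only `x₀`. -/
lemma IsChannelOutput.real_le [IsProbabilityMeasure μ] {ι 𝒳 𝒴 : Type*} [Fintype α] [Finite ι] [Finite 𝒳] {n : ℕ}
    {Z : Ω → α} (hZ : IsUniformRV μ Z) {W : 𝒳 → PMF 𝒴} {𝒰 : Set ι}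
    {C : α → ι → (Fin n → 𝒳)} {u₀ : ι} {Y : Ω → (Fin n → 𝒴)}
    (hY : IsChannelOutput μ W 𝒰 (fun u ω => C (Z ω) u) u₀ Y) {u : ι} (hu : u ∈ 𝒰) (hu₀ : u₀ ∈ 𝒰)
    (x x₀ : Fin n → 𝒳) (y : Fin n → 𝒴) :
    μ.real {ω | C (Z ω) u = x ∧ C (Z ω) u₀ = x₀ ∧ Y ω = y} ≤
      μ.real {ω | C (Z ω) u = x ∧ C (Z ω) u₀ = x₀} * ∏ i, (W (x₀ i) (y i)).toReal := by
  classical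
  have := Fintype.ofFinite ι
  have := Fintype.ofFinite 𝒳
  let F : Finset (𝒰 → Fin n → 𝒳) := Finset.univ.filter fun f => f ⟨u, hu⟩ = x ∧ f ⟨u₀, hu₀⟩ = x₀
  -- Codebooks are indexed by their restriction to `𝒰`, so that their events are disjoint; the value
  -- off `𝒰` is arbitrary.
  let ex : (𝒰 → Fin n → 𝒳) → ι → Fin n → 𝒳 := fun f v => if h : v ∈ 𝒰 then f ⟨v, h⟩ else x
  have hex (f : 𝒰 → Fin n → 𝒳) (v : ι) (hv : v ∈ 𝒰) : ex f v = f ⟨v, hv⟩ := by simp [ex, hv]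
  have hunion : (⋃ f ∈ F, {ω | ∀ v ∈ 𝒰, C (Z ω) v = ex f v}) =
      {ω | C (Z ω) u = x ∧ C (Z ω) u₀ = x₀} := by
    ext ω
    simp only [Set.mem_iUnion, Set.mem_ofPred_eq, exists_prop]
    constructor
    · rintro ⟨f, hf, h⟩
      have hf := (Finset.mem_filter.1 hf).2
      rw [h u hu, h u₀ hu₀, hex f u hu, hex f u₀ hu₀]
      exact hf
    · intro h
      refine ⟨fun v => C (Z ω) v, Finset.mem_filter.2 ⟨Finset.mem_univ _, h⟩, fun v hv => ?_⟩
      exact (hex (fun v => C (Z ω) v) v hv).symm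
  calc μ.real {ω | C (Z ω) u = x ∧ C (Z ω) u₀ = x₀ ∧ Y ω = y}
      ≤ μ.real (⋃ f ∈ F, {ω | (∀ v ∈ 𝒰, C (Z ω) v = ex f v) ∧ Y ω = y}) := by
        refine measureReal_mono ?_ (measure_ne_top _ _)
        rintro ω ⟨h1, h2, h3⟩
        have : ω ∈ ⋃ f ∈ F, {ω | ∀ v ∈ 𝒰, C (Z ω) v = ex f v} := by
          rw [hunion]; exact ⟨h1, h2⟩
        simp only [Set.mem_iUnion, Set.mem_ofPred_eq, exists_prop] at this ⊢
        obtain ⟨f, hf, h⟩ := this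
        exact ⟨f, hf, h, h3⟩
    _ ≤ ∑ f ∈ F, μ.real {ω | (∀ v ∈ 𝒰, C (Z ω) v = ex f v) ∧ Y ω = y} :=
        measureReal_biUnion_finset_le _ _
    _ = ∑ f ∈ F, μ.real {ω | ∀ v ∈ 𝒰, C (Z ω) v = ex f v} * ∏ i, (W (x₀ i) (y i)).toReal := by
        refine Finset.sum_congr rfl fun f hf => ?_
        rw [hY.2 (ex f) y, hex f u₀ hu₀, (Finset.mem_filter.1 hf).2.2]
    _ = _ := by
        rw [← Finset.sum_mul, ← hunion, measureReal_biUnion_finset]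
        · intro f _ f' _ hff'
          rw [Function.onFun, Set.disjoint_left]
          intro ω h h'
          refine hff' (funext fun v => ?_)
          rw [← hex f v v.2, ← hex f' v v.2, ← h v v.2, ← h' v v.2]
        · intro f _
          exact hZ.measurableSet {z | ∀ v ∈ 𝒰, C z v = ex f v}

end Probability

/-! ### Size of the index set, block by block. -/

section IndexSet

variable {p r : ℕ} [Fact p.Prime] {𝒬 β : Type*}

open Classical in
lemma card_indexSet_fiber_le [Fintype 𝒬] [DecidableEq β] (PU : 𝒬 → PMF (ZMod (p ^ r)))
    (g : ZMod (p ^ r) → β) {ε : ℝ}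
    (hε : 0 ≤ ε) (k : 𝒬 → ℕ) (v : (Σ q, Fin (k q)) → β) :
    ((Finset.univ.filter fun u => u ∈ indexSet PU ε k ∧ ∀ i, g (u i) = v i).card : ℝ) ≤
      (2 : ℝ) ^ ∑ q, k q * (fiberEntropy (PU q) g + ε * fiberDev (PU q) g) := by
  have h1 : (Finset.univ.filter fun u => u ∈ indexSet PU ε k ∧ ∀ i, g (u i) = v i).card ≤
      (Fintype.piFinset fun q => Finset.univ.filter fun x : Fin (k q) → ZMod (p ^ r) =>
        x ∈ typicalSet (PU q) ε (k q) ∧ ∀ i, g (x i) = v ⟨q, i⟩).card := by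
    refine Finset.card_le_card_of_injOn (fun u q i => u ⟨q, i⟩) ?_ ?_
    · intro u hu
      have hu := (Finset.mem_filter.1 hu).2
      simp only [Finset.mem_coe, Fintype.mem_piFinset, Finset.mem_filter, Finset.mem_univ, true_and]
      exact fun q => ⟨hu.1 q, fun i => hu.2 ⟨q, i⟩⟩
    · intro u _ u' _ h
      funext ⟨q, i⟩
      exact congrFun (congrFun h q) i
  refine (Nat.cast_le.2 h1).trans ?_
  rw [Fintype.card_piFinset, Nat.cast_prod, Real.rpow_sum_of_pos (by norm_num)]
  exact Finset.prod_le_prod (fun _ _ => Nat.cast_nonneg _)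
    fun q _ => le_trans (Nat.cast_le.2 (Finset.card_le_card fun x hx => by simpa using hx))
      (card_typical_fiber_le (PU q) g hε fun i => v ⟨q, i⟩)

-- Every block loses a factor 1/2 to its atypical mass, hence the term `-|𝒬|` in the exponent.
open Classical in
lemma le_card_indexSet [Fintype 𝒬] (PU : 𝒬 → PMF (ZMod (p ^ r))) {ε : ℝ} (hε : 0 < ε) (k : 𝒬 → ℕ)
    (hk : ∀ q, 0 < k q ∧ 2 * (Fintype.card (ZMod (p ^ r)) : ℝ) ^ 3 / ε ^ 2 ≤ k q) :
    (2 : ℝ) ^ (-(Fintype.card 𝒬 : ℝ) + ∑ q, k q * (fiberEntropy (PU q) (fun _ => ()) -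
      ε * fiberDev (PU q) (fun _ => ()))) ≤
      ((Finset.univ.filter fun u => u ∈ indexSet PU ε k).card : ℝ) := by
  have h1 : (Fintype.piFinset fun q => Finset.univ.filter fun x : Fin (k q) → ZMod (p ^ r) =>
        x ∈ typicalSet (PU q) ε (k q)).card ≤
      (Finset.univ.filter fun u => u ∈ indexSet PU ε k).card := by
    refine Finset.card_le_card_of_injOn (fun x i => x i.1 i.2) ?_ ?_
    · intro x hx
      simp only [Finset.mem_coe, Fintype.mem_piFinset, Finset.mem_filter, Finset.mem_univ,
        true_and] at hx ⊢
      exact hx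
    · intro x _ x' _ h
      funext q i
      exact congrFun h ⟨q, i⟩
  refine le_trans ?_ (Nat.cast_le.2 h1)
  rw [Fintype.card_piFinset, Nat.cast_prod, Real.rpow_add (by norm_num),
    Real.rpow_sum_of_pos (by norm_num), Real.rpow_neg (by norm_num), Real.rpow_natCast,
    ← inv_pow, ← Finset.card_univ, ← Finset.prod_const, ← Finset.prod_mul_distrib]
  refine Finset.prod_le_prod (fun _ _ => by positivity) fun q _ => ?_
  have := le_card_typical (PU q) hε (hk q).2 (hk q).1
  rwa [one_div] at this

lemma eq_of_mem_indexSet {PU : 𝒬 → PMF (ZMod (p ^ r))} {g : ZMod (p ^ r) → β} {ε : ℝ} {k : 𝒬 → ℕ}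
    (h0 : ∀ q, fiberEntropy (PU q) g = 0) {u v : (Σ q, Fin (k q)) → ZMod (p ^ r)}
    (hu : u ∈ indexSet PU ε k) (hv : v ∈ indexSet PU ε k) (huv : ∀ i, g (u i) = g (v i)) :
    u = v := by
  funext ⟨q, i⟩
  exact eq_of_fiberEntropy_eq_zero (h0 q) (ne_zero_of_mem_typicalSet (hu q) i)
    (ne_zero_of_mem_typicalSet (hv q) i) (huv _)

end IndexSet

/-! ### Counting generators: prescribed codewords, collisions, small images. -/

section Count

variable {p r : ℕ} {𝒬 : Type*} [Fintype 𝒬] {n : ℕ} {k : 𝒬 → ℕ}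

lemma codeword_sub_codeword (G : Matrix (Σ q, Fin (k q)) (Fin n) (ZMod (p ^ r)))
    (b : Fin n → ZMod (p ^ r)) (u v : (Σ q, Fin (k q)) → ZMod (p ^ r)) :
    codeword G b u - codeword G b v = Matrix.vecMul (u - v) G := by
  rw [codeword, codeword, add_sub_add_right_eq_sub, Matrix.sub_vecMul]

/-- The difference of the codewords constrains `G` alone, and then the first codeword determines the
dither `b`. -/
lemma card_codeword_pair_mul_le [Fact p.Prime] [DecidableEq 𝒬] {s : ℕ} (hs : s < r)
    {u v : (Σ q, Fin (k q)) → ZMod (p ^ r)}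
    (huv : ∃ j, ¬ (p : ZMod (p ^ r)) ^ (s + 1) ∣ (u - v) j) (x y : Fin n → ZMod (p ^ r)) :
    (Finset.univ.filter fun z : Matrix (Σ q, Fin (k q)) (Fin n) (ZMod (p ^ r)) ×
        (Fin n → ZMod (p ^ r)) => codeword z.1 z.2 u = x ∧ codeword z.1 z.2 v = y).card *
      (p ^ (r - s)) ^ n ≤ Fintype.card (Matrix (Σ q, Fin (k q)) (Fin n) (ZMod (p ^ r))) := by
  obtain ⟨j, hj⟩ := huv
  refine le_trans (Nat.mul_le_mul_right _ ?_) (card_vecMul_eq_mul_le hs hj (x - y))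
  refine Finset.card_le_card_of_injOn Prod.fst ?_ ?_
  · intro z hz
    obtain ⟨h1, h2⟩ := (Finset.mem_filter.1 hz).2
    simp [← codeword_sub_codeword z.1 z.2 u v, h1, h2]
  · intro z hz z' hz' h
    obtain ⟨h1, -⟩ := (Finset.mem_filter.1 hz).2
    obtain ⟨h1', -⟩ := (Finset.mem_filter.1 hz').2
    refine Prod.ext h ?_
    rw [← h1', codeword, codeword, h] at h1
    exact add_left_cancel h1

lemma card_codeword_eq_mul_le [Fact p.Prime] [DecidableEq 𝒬] {s : ℕ} (hs : s < r)
    {u v : (Σ q, Fin (k q)) → ZMod (p ^ r)}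
    (huv : ∃ j, ¬ (p : ZMod (p ^ r)) ^ (s + 1) ∣ (u - v) j) :
    (Finset.univ.filter fun z : Matrix (Σ q, Fin (k q)) (Fin n) (ZMod (p ^ r)) ×
        (Fin n → ZMod (p ^ r)) => codeword z.1 z.2 u = codeword z.1 z.2 v).card *
      (p ^ (r - s)) ^ n ≤ Fintype.card (Matrix (Σ q, Fin (k q)) (Fin n) (ZMod (p ^ r)) ×
        (Fin n → ZMod (p ^ r))) := by
  obtain ⟨j, hj⟩ := huv
  have h1 : (Finset.univ.filter fun z : Matrix (Σ q, Fin (k q)) (Fin n) (ZMod (p ^ r)) ×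
        (Fin n → ZMod (p ^ r)) => codeword z.1 z.2 u = codeword z.1 z.2 v) =
      (Finset.univ.filter fun G : Matrix (Σ q, Fin (k q)) (Fin n) (ZMod (p ^ r)) =>
        Matrix.vecMul (u - v) G = 0) ×ˢ Finset.univ := by
    ext z
    simp [← codeword_sub_codeword z.1 z.2 u v, sub_eq_zero]
  rw [h1, Finset.card_product, Finset.card_univ, Fintype.card_prod, mul_right_comm]
  exact Nat.mul_le_mul_right _ (card_vecMul_eq_mul_le hs hj 0)

/-- Cauchy-Schwarz for the fibre sizes: their sum is `|U|`, and the sum of their squares counts the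
colliding pairs. -/
lemma sq_card_le_card_image_mul {ι X : Type*} [DecidableEq X] (U : Finset ι) (f : ι → X) :
    U.card ^ 2 ≤ (U.image f).card * ∑ u ∈ U, ∑ v ∈ U, if f u = f v then 1 else 0 := by
  have h1 : U.card = ∑ x ∈ U.image f, (U.filter fun u => f u = x).card :=
    Finset.card_eq_sum_card_image f U
  have h2 : ∑ u ∈ U, ∑ v ∈ U, (if f u = f v then 1 else 0) =
      ∑ x ∈ U.image f, (U.filter fun u => f u = x).card ^ 2 := by
    have : ∀ u ∈ U, ∑ v ∈ U, (if f u = f v then 1 else 0) =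
        (fun x => (U.filter fun v => f v = x).card) (f u) := by
      intro u _
      simp only [Finset.card_filter]
      exact Finset.sum_congr rfl fun v _ => if_congr eq_comm rfl rfl
    rw [Finset.sum_congr rfl this,
      Finset.sum_comp (fun x => (U.filter fun v => f v = x).card) f]
    simp [sq]
  rw [h2]
  conv_lhs => rw [h1]
  exact sq_sum_le_card_mul_sum_sq

-- Markov's inequality: an image of size at most `L` forces at least `|U|² / L` colliding pairs, so
-- few `z` can have one.
open Classical in
lemma card_small_image_mul_le {ι X Z : Type*} [Fintype Z] [DecidableEq X] (U : Finset ι) (C : Z → ι → X) {L : ℝ}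
    (hL : 0 ≤ L) :
    ((Finset.univ.filter fun z => ((U.image (C z)).card : ℝ) ≤ L).card : ℝ) * (U.card : ℝ) ^ 2 ≤
      L * ∑ u ∈ U, ∑ v ∈ U, ((Finset.univ.filter fun z => C z u = C z v).card : ℝ) := by
  have h1 : ∑ u ∈ U, ∑ v ∈ U, ((Finset.univ.filter fun z => C z u = C z v).card : ℝ) =
      ∑ z, ((∑ u ∈ U, ∑ v ∈ U, if C z u = C z v then 1 else 0 : ℕ) : ℝ) := by
    simp only [Finset.card_filter, Nat.cast_sum]
    rw [Finset.sum_comm]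
    conv_rhs => rw [Finset.sum_comm]
    rw [Finset.sum_comm]
    refine Finset.sum_congr rfl fun u _ => ?_
    rw [Finset.sum_comm]
  rw [h1, Finset.mul_sum, ← nsmul_eq_mul, ← Finset.sum_const]
  refine le_trans (Finset.sum_le_sum fun z hz => ?_)
    (Finset.sum_le_sum_of_subset_of_nonneg (Finset.filter_subset _ _) fun z _ _ =>
      mul_nonneg hL (Nat.cast_nonneg _))
  have hz := (Finset.mem_filter.1 hz).2
  have h2 : ((U.card ^ 2 : ℕ) : ℝ) ≤ _ := Nat.cast_le.2 (sq_card_le_card_image_mul U (C z))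
  rw [Nat.cast_mul, Nat.cast_pow] at h2
  exact h2.trans (mul_le_mul_of_nonneg_right hz (Nat.cast_nonneg _))

end Count

/-! ### Probability of a typical competitor and of a small code. -/

section Bounds

open MeasureTheory

variable {p r : ℕ} [Fact p.Prime] {𝒬 𝒴 : Type*} [Fintype 𝒬] [Fintype 𝒴] {n : ℕ} {k : 𝒬 → ℕ}
  {PU : 𝒬 → PMF (ZMod (p ^ r))} {W : ZMod (p ^ r) → PMF 𝒴} {ε : ℝ}
  {Ω : Type*} [MeasurableSpace Ω] {μ : Measure Ω} [IsProbabilityMeasure μ]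
  {G : Ω → Matrix (Σ q, Fin (k q)) (Fin n) (ZMod (p ^ r))} {B : Ω → Fin n → ZMod (p ^ r)}
  {Y : Ω → Fin n → 𝒴}

open Classical in
lemma card_typical_pair_le (P : PMF (ZMod (p ^ r) × 𝒴)) (hε : 0 ≤ ε) (s : ℕ)
    (x₀ : Fin n → ZMod (p ^ r)) (y : Fin n → 𝒴) :
    ((Finset.univ.filter fun x : Fin n → ZMod (p ^ r) =>
        (fun i => (x i, y i)) ∈ typicalSet P ε n ∧
          ∀ i, trunc p r s (x i) = trunc p r s (x₀ i)).card : ℝ) ≤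
      (2 : ℝ) ^ (n * (fiberEntropy P (fun t => (t.2, trunc p r s t.1)) +
        ε * fiberDev P (fun t => (t.2, trunc p r s t.1)))) := by
  refine le_trans (Nat.cast_le.2 ?_) (card_typical_fiber_le P (fun t => (t.2, trunc p r s t.1)) hε
    fun i => (y i, trunc p r s (x₀ i)))
  refine Finset.card_le_card_of_injOn (fun x i => (x i, y i)) ?_ ?_
  · intro x hx
    simpa using hx
  · intro x _ x' _ h
    funext i
    exact congrArg Prod.fst (congrFun h i)

/-- Sum over the true codeword, the output and the competitor. The channel probabilities sum to 1
and the choices of `x₀` absorb the uniform factor, leaving the number of admissible competitors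
times `p^{-(r-s)n}`. -/
lemma real_typical_le (P : PMF (ZMod (p ^ r) × 𝒴)) (hε : 0 ≤ ε)
    (hGB : IsUniformRV μ (fun ω => (G ω, B ω))) {u u₀ : (Σ q, Fin (k q)) → ZMod (p ^ r)}
    (hY : IsChannelOutput μ W (indexSet PU ε k) (fun u ω => codeword (G ω) (B ω) u) u₀ Y)
    (hu : u ∈ indexSet PU ε k) (hu₀ : u₀ ∈ indexSet PU ε k) {s : ℕ} (hs : s < r)
    (hlow : ∀ i, trunc p r s (u i) = trunc p r s (u₀ i))
    (hhigh : ∃ j, ¬ (p : ZMod (p ^ r)) ^ (s + 1) ∣ (u - u₀) j) :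
    μ.real {ω | (fun i => (codeword (G ω) (B ω) u i, Y ω i)) ∈ typicalSet P ε n} ≤
      (2 : ℝ) ^ (n * (fiberEntropy P (fun t => (t.2, trunc p r s t.1)) +
        ε * fiberDev P (fun t => (t.2, trunc p r s t.1)))) * (((p : ℝ) ^ (r - s)) ^ n)⁻¹ := by
  classical
  set M := (2 : ℝ) ^ (n * (fiberEntropy P (fun t => (t.2, trunc p r s t.1)) +
        ε * fiberDev P (fun t => (t.2, trunc p r s t.1)))) with hM
  have hM0 : 0 ≤ M := by positivity
  have hp : (0 : ℝ) < p := by exact_mod_cast (Fact.out : p.Prime).pos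
  set N : ℝ := ((Fintype.card (Fin n → ZMod (p ^ r)) : ℕ) : ℝ) with hN
  have hN0 : 0 < N := by rw [hN]; exact_mod_cast Fintype.card_pos
  let X (x₀ : Fin n → ZMod (p ^ r)) (y : Fin n → 𝒴) : Finset (Fin n → ZMod (p ^ r)) :=
    Finset.univ.filter fun x => (fun i => (x i, y i)) ∈ typicalSet P ε n ∧
      ∀ i, trunc p r s (x i) = trunc p r s (x₀ i)
  have hpair (x x₀ : Fin n → ZMod (p ^ r)) :
      μ.real {ω | codeword (G ω) (B ω) u = x ∧ codeword (G ω) (B ω) u₀ = x₀} ≤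
        N⁻¹ * (((p : ℝ) ^ (r - s)) ^ n)⁻¹ := by
    have h1 := hGB.real_eq fun z => codeword z.1 z.2 u = x ∧ codeword z.1 z.2 u₀ = x₀
    dsimp only at h1
    rw [h1]
    have h2 := card_codeword_pair_mul_le hs hhigh x x₀
    have h3 := (Nat.cast_le (α := ℝ)).2 h2
    rw [Nat.cast_mul, ← le_div_iff₀ (by push_cast; positivity)] at h3
    rw [div_le_iff₀ (by exact_mod_cast Fintype.card_pos)]
    refine h3.trans (le_of_eq ?_)
    rw [Fintype.card_prod, Nat.cast_mul, ← hN]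
    push_cast
    field_simp
  have hsub : {ω | (fun i => (codeword (G ω) (B ω) u i, Y ω i)) ∈ typicalSet P ε n} ⊆
      ⋃ x₀ ∈ (Finset.univ : Finset (Fin n → ZMod (p ^ r))),
        ⋃ y ∈ (Finset.univ : Finset (Fin n → 𝒴)), ⋃ x ∈ X x₀ y,
        {ω | codeword (G ω) (B ω) u = x ∧ codeword (G ω) (B ω) u₀ = x₀ ∧ Y ω = y} := by
    intro ω hω
    simp only [Set.mem_iUnion, Set.mem_ofPred_eq, exists_prop, Finset.mem_univ, true_and]
    refine ⟨codeword (G ω) (B ω) u₀, Y ω, codeword (G ω) (B ω) u, ?_, rfl, rfl, rfl⟩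
    refine Finset.mem_filter.2 ⟨Finset.mem_univ _, hω, fun i => ?_⟩
    -- Linearity carries the congruence of indices modulo `p^s` over to the codewords.
    rw [trunc_eq_trunc_iff hs.le, ← Pi.sub_apply, codeword_sub_codeword]
    exact Finset.dvd_sum fun j _ =>
      Dvd.dvd.mul_right ((trunc_eq_trunc_iff hs.le _ _).1 (hlow j)) _
  refine (measureReal_mono hsub (measure_ne_top _ _)).trans ?_
  refine (measureReal_biUnion_finset_le _ _).trans ?_
  calc _ ≤ ∑ x₀ : Fin n → ZMod (p ^ r), ∑ y : Fin n → 𝒴, ∑ x ∈ X x₀ y,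
        N⁻¹ * (((p : ℝ) ^ (r - s)) ^ n)⁻¹ * ∏ i, (W (x₀ i) (y i)).toReal := by
        refine Finset.sum_le_sum fun x₀ _ => ?_
        refine (measureReal_biUnion_finset_le _ _).trans (Finset.sum_le_sum fun y _ => ?_)
        refine (measureReal_biUnion_finset_le _ _).trans (Finset.sum_le_sum fun x _ => ?_)
        refine (IsChannelOutput.real_le (C := fun z u => codeword z.1 z.2 u) hGB hY hu hu₀
          x x₀ y).trans ?_
        exact mul_le_mul_of_nonneg_right (hpair x x₀)
          (Finset.prod_nonneg fun _ _ => ENNReal.toReal_nonneg)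
    _ ≤ ∑ x₀ : Fin n → ZMod (p ^ r), ∑ y : Fin n → 𝒴,
        M * (N⁻¹ * (((p : ℝ) ^ (r - s)) ^ n)⁻¹ * ∏ i, (W (x₀ i) (y i)).toReal) := by
        refine Finset.sum_le_sum fun x₀ _ => Finset.sum_le_sum fun y _ => ?_
        rw [Finset.sum_const, nsmul_eq_mul]
        refine mul_le_mul_of_nonneg_right (card_typical_pair_le P hε s x₀ y) ?_
        have : 0 ≤ ∏ i, (W (x₀ i) (y i)).toReal :=
          Finset.prod_nonneg fun _ _ => ENNReal.toReal_nonneg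
        positivity
    _ = ∑ x₀ : Fin n → ZMod (p ^ r), M * (N⁻¹ * (((p : ℝ) ^ (r - s)) ^ n)⁻¹) := by
        refine Finset.sum_congr rfl fun x₀ _ => ?_
        have h1 : ∑ y : Fin n → 𝒴, ∏ i, (W (x₀ i) (y i)).toReal = 1 := by
          have := Finset.prod_univ_sum (fun _ : Fin n => (Finset.univ : Finset 𝒴))
            fun i a => (W (x₀ i) a).toReal
          rw [Fintype.piFinset_univ] at this
          rw [← this]
          simp [sum_toReal]
        simp only [← mul_assoc]
        rw [← Finset.mul_sum, h1, mul_one]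
    _ = M * (((p : ℝ) ^ (r - s)) ^ n)⁻¹ := by
        rw [Finset.sum_const, nsmul_eq_mul, Finset.card_univ, ← hN]
        field_simp

/-- Union bound: `A` contains all levels at which two distinct indices can first differ. -/
lemma real_exists_typical_le (P : PMF (ZMod (p ^ r) × 𝒴)) (hε : 0 ≤ ε)
    (hGB : IsUniformRV μ (fun ω => (G ω, B ω))) {u₀ : (Σ q, Fin (k q)) → ZMod (p ^ r)}
    (hY : IsChannelOutput μ W (indexSet PU ε k) (fun u ω => codeword (G ω) (B ω) u) u₀ Y)
    (hu₀ : u₀ ∈ indexSet PU ε k) (A : Finset ℕ)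
    (hA : ∀ u ∈ indexSet PU ε k, u ≠ u₀ → ∃ s ∈ A, s < r ∧
      (∀ i, trunc p r s (u i) = trunc p r s (u₀ i)) ∧
      ∃ j, ¬ (p : ZMod (p ^ r)) ^ (s + 1) ∣ (u - u₀) j) :
    μ.real {ω | ∃ x ∈ code PU ε (G ω) (B ω), (fun i => (x i, Y ω i)) ∈ typicalSet P ε n ∧
        x ≠ codeword (G ω) (B ω) u₀} ≤
      ∑ s ∈ A, (2 : ℝ) ^ (∑ q, k q * (fiberEntropy (PU q) (trunc p r s) +
          ε * fiberDev (PU q) (trunc p r s))) *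
        ((2 : ℝ) ^ (n * (fiberEntropy P (fun t => (t.2, trunc p r s t.1)) +
        ε * fiberDev P (fun t => (t.2, trunc p r s t.1)))) * (((p : ℝ) ^ (r - s)) ^ n)⁻¹) := by
  classical
  let T (s : ℕ) : Finset ((Σ q, Fin (k q)) → ZMod (p ^ r)) :=
    Finset.univ.filter fun u => (u ∈ indexSet PU ε k ∧
      ∀ i, trunc p r s (u i) = trunc p r s (u₀ i)) ∧ s < r ∧
      ∃ j, ¬ (p : ZMod (p ^ r)) ^ (s + 1) ∣ (u - u₀) j
  have hsub : {ω | ∃ x ∈ code PU ε (G ω) (B ω), (fun i => (x i, Y ω i)) ∈ typicalSet P ε n ∧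
        x ≠ codeword (G ω) (B ω) u₀} ⊆ ⋃ s ∈ A, ⋃ u ∈ T s,
      {ω | (fun i => (codeword (G ω) (B ω) u i, Y ω i)) ∈ typicalSet P ε n} := by
    rintro ω ⟨x, ⟨u, hu, rfl⟩, htyp, hne⟩
    obtain ⟨s, hsA, hs, hlow, hhigh⟩ := hA u hu (fun h => hne (by rw [h]))
    simp only [Set.mem_iUnion, exists_prop]
    exact ⟨s, hsA, u, Finset.mem_filter.2 ⟨Finset.mem_univ _, ⟨hu, hlow⟩, hs, hhigh⟩, htyp⟩
  refine (measureReal_mono hsub (measure_ne_top _ _)).trans ?_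
  refine (measureReal_biUnion_finset_le _ _).trans (Finset.sum_le_sum fun s _ => ?_)
  refine (measureReal_biUnion_finset_le _ _).trans ?_
  calc _ ≤ ∑ u ∈ T s, (2 : ℝ) ^ (n * (fiberEntropy P (fun t => (t.2, trunc p r s t.1)) +
        ε * fiberDev P (fun t => (t.2, trunc p r s t.1)))) * (((p : ℝ) ^ (r - s)) ^ n)⁻¹ := by
        refine Finset.sum_le_sum fun u hu => ?_
        obtain ⟨⟨h1, h2⟩, h3, h4⟩ := (Finset.mem_filter.1 hu).2
        exact real_typical_le P hε hGB hY h1 hu₀ h3 h2 h4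
    _ ≤ _ := by
        rw [Finset.sum_const, nsmul_eq_mul]
        refine mul_le_mul_of_nonneg_right ?_ (by positivity)
        refine le_trans (Nat.cast_le.2 (Finset.card_le_card ?_)) (card_indexSet_fiber_le PU
          (trunc p r s) hε k fun i => trunc p r s (u₀ i))
        intro u hu
        exact Finset.mem_filter.2 ⟨Finset.mem_univ _, (Finset.mem_filter.1 hu).2.1⟩

open Classical in
/-- A code much smaller than its index set is unlikely: `A` contains all levels at which two
distinct indices can first differ. -/
lemma real_ncard_code_le (hε : 0 ≤ ε) (hGB : IsUniformRV μ (fun ω => (G ω, B ω))) (A : Finset ℕ)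
    (hA : ∀ u ∈ indexSet PU ε k, ∀ v ∈ indexSet PU ε k, u ≠ v → ∃ s ∈ A, s < r ∧
      (∀ i, trunc p r s (u i) = trunc p r s (v i)) ∧
      ∃ j, ¬ (p : ZMod (p ^ r)) ^ (s + 1) ∣ (u - v) j) {L : ℝ} (hL : 0 ≤ L)
    (hne : (indexSet PU ε k).Nonempty) :
    μ.real {ω | ((code PU ε (G ω) (B ω)).ncard : ℝ) ≤ L} ≤
      L / ((Finset.univ.filter fun u => u ∈ indexSet PU ε k).card : ℝ) *
      (1 + ∑ s ∈ A, (2 : ℝ) ^ (∑ q, k q * (fiberEntropy (PU q) (trunc p r s) +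
          ε * fiberDev (PU q) (trunc p r s))) * (((p : ℝ) ^ (r - s)) ^ n)⁻¹) := by
  set U := Finset.univ.filter fun u => u ∈ indexSet PU ε k with hU
  have hU0 : (0 : ℝ) < U.card := by
    obtain ⟨u, hu⟩ := hne
    exact_mod_cast Finset.card_pos.2 ⟨u, by simp [hU, hu]⟩
  have hp : (0 : ℝ) < p := by exact_mod_cast (Fact.out : p.Prime).pos
  set N : ℝ := ((Fintype.card (Matrix (Σ q, Fin (k q)) (Fin n) (ZMod (p ^ r)) ×
        (Fin n → ZMod (p ^ r))) : ℕ) : ℝ) with hN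
  have hN0 : 0 < N := by rw [hN]; exact_mod_cast Fintype.card_pos
  set S := ∑ s ∈ A, (2 : ℝ) ^ (∑ q, k q * (fiberEntropy (PU q) (trunc p r s) +
          ε * fiberDev (PU q) (trunc p r s))) * (((p : ℝ) ^ (r - s)) ^ n)⁻¹ with hS
  have hcode (ω : Ω) : (code PU ε (G ω) (B ω)).ncard =
      (U.image (codeword (G ω) (B ω))).card := by
    rw [← Set.ncard_coe_finset]
    congr 1
    ext x
    simp [code, hU]
  have hcoll (u : (Σ q, Fin (k q)) → ZMod (p ^ r)) (hu : u ∈ U) :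
      ∑ v ∈ U, ((Finset.univ.filter fun z : Matrix (Σ q, Fin (k q)) (Fin n) (ZMod (p ^ r)) ×
        (Fin n → ZMod (p ^ r)) => codeword z.1 z.2 u = codeword z.1 z.2 v).card : ℝ) ≤
        N * (1 + S) := by
    -- The diagonal contributes all of `N`; any other `v` is charged to the level at which it
    -- separates from `u`.
    have hterm (v : (Σ q, Fin (k q)) → ZMod (p ^ r)) (hv : v ∈ U) :
        ((Finset.univ.filter fun z : Matrix (Σ q, Fin (k q)) (Fin n) (ZMod (p ^ r)) ×
        (Fin n → ZMod (p ^ r)) => codeword z.1 z.2 u = codeword z.1 z.2 v).card : ℝ) ≤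
        (if u = v then N else 0) + ∑ s ∈ A, if (∀ i, trunc p r s (v i) = trunc p r s (u i)) then
          N * (((p : ℝ) ^ (r - s)) ^ n)⁻¹ else 0 := by
      have hnn : ∀ s ∈ A, (0 : ℝ) ≤ if (∀ i, trunc p r s (v i) = trunc p r s (u i)) then
          N * (((p : ℝ) ^ (r - s)) ^ n)⁻¹ else 0 := by
        intro s _
        split_ifs
        · positivity
        · rfl
      by_cases huv : u = v
      · rw [if_pos huv]
        refine le_add_of_le_of_nonneg ?_ (Finset.sum_nonneg hnn)
        exact Nat.cast_le.2 (Finset.card_le_univ _)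
      · rw [if_neg huv, zero_add]
        obtain ⟨s, hsA, hs, hlow, hhigh⟩ := hA u (Finset.mem_filter.1 hu).2 v
          (Finset.mem_filter.1 hv).2 huv
        refine le_trans ?_ (Finset.single_le_sum hnn hsA)
        rw [if_pos fun i => (hlow i).symm, ← div_eq_mul_inv, le_div_iff₀ (by positivity)]
        rw [hN]
        exact_mod_cast card_codeword_eq_mul_le hs hhigh
    refine (Finset.sum_le_sum hterm).trans ?_
    rw [Finset.sum_add_distrib, Finset.sum_ite_eq, if_pos hu, mul_add, mul_one, Finset.sum_comm]
    refine add_le_add_right ?_ _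
    rw [hS, Finset.mul_sum]
    refine Finset.sum_le_sum fun s _ => ?_
    rw [← Finset.sum_filter, Finset.sum_const, nsmul_eq_mul]
    have h1 := card_indexSet_fiber_le PU (trunc p r s) hε k fun i => trunc p r s (u i)
    rw [← Finset.filter_filter] at h1
    calc _ ≤ (2 : ℝ) ^ (∑ q, k q * (fiberEntropy (PU q) (trunc p r s) +
          ε * fiberDev (PU q) (trunc p r s))) * (N * (((p : ℝ) ^ (r - s)) ^ n)⁻¹) :=
          mul_le_mul_of_nonneg_right h1 (by positivity)
      _ = _ := by ring
  have hreal := hGB.real_eq fun z => ((U.image (codeword z.1 z.2)).card : ℝ) ≤ L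
  simp only [hcode]
  dsimp only at hreal
  rw [hreal, div_le_iff₀ (by exact_mod_cast Fintype.card_pos), ← hN]
  have h2 := card_small_image_mul_le U (fun z : Matrix (Σ q, Fin (k q)) (Fin n) (ZMod (p ^ r)) ×
        (Fin n → ZMod (p ^ r)) => codeword z.1 z.2) hL
  have h3 := h2.trans (mul_le_mul_of_nonneg_left (Finset.sum_le_sum hcoll) hL)
  rw [Finset.sum_const, nsmul_eq_mul, ← le_div_iff₀ (by positivity)] at h3
  refine h3.trans (le_of_eq ?_)
  field_simp

end Bounds

/-! ### Comparison of exponents. -/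

section Exponents

variable {𝒬 : Type*} [Fintype 𝒬] {P e d : 𝒬 → ℝ} {k : 𝒬 → ℕ} {n : ℕ} {c ε : ℝ}

/-- Rounding changes each block length by less than 1, so its cost does not grow with `n`. -/
lemma sum_blockLength_mul_le (he : ∀ q, 0 ≤ e q) (hd : ∀ q, 0 ≤ d q) (hε : 0 ≤ ε)
    (hk : ∀ q, |(k q : ℝ) - c * n * P q| < 1) :
    ∑ q, k q * (e q + ε * d q) ≤
      n * (c * ∑ q, P q * e q + ε * (c * ∑ q, P q * d q)) + ∑ q, (e q + ε * d q) := by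
  have h (q : 𝒬) : k q * (e q + ε * d q) ≤
      n * (c * (P q * e q) + ε * (c * (P q * d q))) + (e q + ε * d q) := by
    have h1 := (abs_lt.1 (hk q)).2
    have h2 : 0 ≤ e q + ε * d q := add_nonneg (he q) (mul_nonneg hε (hd q))
    nlinarith [mul_le_mul_of_nonneg_right h1.le h2]
  refine (Finset.sum_le_sum fun q _ => h q).trans (le_of_eq ?_)
  simp only [Finset.sum_add_distrib, ← Finset.mul_sum]

lemma le_sum_blockLength_mul (he : ∀ q, 0 ≤ e q) (hd : ∀ q, 0 ≤ d q) (hε : 0 ≤ ε)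
    (hk : ∀ q, |(k q : ℝ) - c * n * P q| < 1) :
    n * (c * ∑ q, P q * e q - ε * (c * ∑ q, P q * d q)) - ∑ q, (e q + ε * d q) ≤
      ∑ q, k q * (e q - ε * d q) := by
  have h (q : 𝒬) : n * (c * (P q * e q) - ε * (c * (P q * d q))) - (e q + ε * d q) ≤
      k q * (e q - ε * d q) := by
    obtain ⟨h1, h2⟩ := abs_lt.1 (hk q)
    nlinarith [mul_le_mul_of_nonneg_right h1.le (he q),
      mul_le_mul_of_nonneg_right h2.le (mul_nonneg hε (hd q))]
  refine le_trans (le_of_eq ?_) (Finset.sum_le_sum fun q _ => h q)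
  simp only [Finset.sum_sub_distrib, ← Finset.mul_sum]

lemma inv_pow_pow_eq_rpow {p : ℝ} (hp : 0 < p) (m n : ℕ) :
    ((p ^ m) ^ n)⁻¹ = (2 : ℝ) ^ (-(n * Real.logb 2 (p ^ m))) := by
  rw [Real.rpow_neg (by norm_num), mul_comm (n : ℝ), Real.rpow_mul (by norm_num),
    Real.rpow_logb (by norm_num) (by norm_num) (by positivity), Real.rpow_natCast]

/-- If the rate bound at some level `t` is below the index rate `c H`, then every `m` not exceeding
the rate bounds stays below the exponent of the typical code size at each level `s`. -/
lemma le_sub_of_le_rateBound {c H Hs as hs Ht at' ht D m : ℝ} (hHs : 0 < Hs) (hHsH : Hs ≤ H)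
    (hHt : 0 < Ht) (hHtH : Ht ≤ H) (hD : 0 ≤ D) (hhs : 0 ≤ hs)
    (ht3 : at' - ht - 3 * D < c * Ht) (hmt : m ≤ H / Ht * (at' - ht - 6 * D))
    (hms : m ≤ H / Hs * (as - hs - 6 * D)) :
    m ≤ c * H - 3 * D ∧ m ≤ c * H - c * Hs + as - 3 * D := by
  have hρt : 1 ≤ H / Ht := (one_le_div hHt).2 hHtH
  have hρs : 1 ≤ H / Hs := (one_le_div hHs).2 hHsH
  have et : H / Ht * Ht = H := div_mul_cancel₀ _ hHt.ne'
  have es : H / Hs * Hs = H := div_mul_cancel₀ _ hHs.ne'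
  set ρt := H / Ht
  set ρs := H / Hs
  have h1 : m ≤ c * H - 3 * D := by
    have : ρt * (at' - ht - 6 * D) ≤ ρt * (c * Ht - 3 * D) :=
      mul_le_mul_of_nonneg_left (by linarith) (by linarith)
    have h2 : ρt * (c * Ht - 3 * D) = c * H - 3 * (ρt * D) := by rw [← et]; ring
    nlinarith [mul_le_mul_of_nonneg_right hρt hD]
  refine ⟨h1, ?_⟩
  -- If `c Hs ≤ as`, the second bound is weaker than the first. Otherwise `ρs * as` is at most `as +
  -- (ρs - 1) * (c Hs)`, which is `as + c H - c Hs`.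
  rcases le_or_gt (c * Hs) as with hle | hlt
  · linarith
  · have h2 : (ρs - 1) * as ≤ (ρs - 1) * (c * Hs) :=
      mul_le_mul_of_nonneg_left hlt.le (by linarith)
    have h3 : (ρs - 1) * (c * Hs) = c * H - c * Hs := by rw [← es]; ring
    have h4 : 1 * D ≤ ρs * D := mul_le_mul_of_nonneg_right hρs hD
    have h5 : 0 ≤ ρs * hs := mul_nonneg (by linarith) hhs
    nlinarith

end Exponents

end QGC

end

/-! ### The packing bound. -/

theorem mainTheorem5 {p r : ℕ} [Fact p.Prime] {𝒬 𝒴 : Type*} [Fintype 𝒬] [Fintype 𝒴]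
    (PQ : PMF 𝒬) (hPQ : ∀ q, 0 < PQ q) (PU : 𝒬 → PMF (ZMod (p ^ r)))
    (PX : PMF (ZMod (p ^ r))) (W : ZMod (p ^ r) → PMF 𝒴) (c : ℝ) (hc : 0 < c) :
    ∃ η : ℝ → ℝ, Filter.Tendsto η (𝓝[>] 0) (𝓝 0) ∧
      ∀ ε > 0, ∀ δ > 0, ∃ N : ℕ, ∀ n > N,
        -- block lengths: `c n P_Q(q)`, rounded up or down if it is not an integer
        ∀ k : 𝒬 → ℕ, (∀ q, |(k q : ℝ) - c * n * (PQ q).toReal| < 1) →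
        ∀ u₀ ∈ QGC.indexSet PU ε k,
        ∀ (Ω : Type*) [MeasurableSpace Ω] (μ : MeasureTheory.Measure Ω)
          [MeasureTheory.IsProbabilityMeasure μ]
          (G : Ω → Matrix (Σ q, Fin (k q)) (Fin n) (ZMod (p ^ r)))
          (B : Ω → Fin n → ZMod (p ^ r)) (Y : Ω → Fin n → 𝒴),
          QGC.IsUniformRV μ (fun ω => (G ω, B ω)) →
          QGC.IsChannelOutput μ W (QGC.indexSet PU ε k)
            (fun u ω => QGC.codeword (G ω) (B ω) u) u₀ Y →
          μ.real {ω |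
            -- the rate condition; an index `s` with `H(U|Q,[U]_s) = 0` imposes no constraint
            (∀ s < r,
              QGC.condEntropy (QGC.pairLaw PQ PU) (fun t => t.2)
                (fun t => (t.1, QGC.trunc p r s t.2)) ≠ 0 →
              QGC.rate (QGC.code PU ε (G ω) (B ω)) <
                QGC.condEntropy (QGC.pairLaw PQ PU) (fun t => t.2) (fun t => t.1) /
                  QGC.condEntropy (QGC.pairLaw PQ PU) (fun t => t.2)
                    (fun t => (t.1, QGC.trunc p r s t.2)) *
                (Real.logb 2 ((p : ℝ) ^ (r - s)) -
                  QGC.condEntropy (QGC.pairLaw PX W) (fun t => t.1)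
                    (fun t => (t.2, QGC.trunc p r s t.1)) + η ε)) ∧
            ∃ x ∈ QGC.code PU ε (G ω) (B ω),
              (fun i => (x i, Y ω i)) ∈ QGC.typicalSet (QGC.pairLaw PX W) ε n ∧
              x ≠ QGC.codeword (G ω) (B ω) u₀} < δ := by
  classical
  have hp : (0 : ℝ) < p := by exact_mod_cast (Fact.out : p.Prime).pos
  let e (s : ℕ) (q : 𝒬) : ℝ := QGC.fiberEntropy (PU q) (QGC.trunc p r s)
  let d (s : ℕ) (q : 𝒬) : ℝ := QGC.fiberDev (PU q) (QGC.trunc p r s)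
  let e₀ (q : 𝒬) : ℝ := QGC.fiberEntropy (PU q) (fun _ => ())
  let d₀ (q : 𝒬) : ℝ := QGC.fiberDev (PU q) (fun _ => ())
  let h (s : ℕ) : ℝ := QGC.fiberEntropy (QGC.pairLaw PX W) (fun t => (t.2, QGC.trunc p r s t.1))
  let dX (s : ℕ) : ℝ := QGC.fiberDev (QGC.pairLaw PX W) (fun t => (t.2, QGC.trunc p r s t.1))
  let a (s : ℕ) : ℝ := Real.logb 2 ((p : ℝ) ^ (r - s))
  let H (s : ℕ) : ℝ := ∑ q, (PQ q).toReal * e s q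
  let H₀ : ℝ := ∑ q, (PQ q).toReal * e₀ q
  have he (s : ℕ) (q : 𝒬) : 0 ≤ e s q := QGC.fiberEntropy_nonneg _ _
  have hd (s : ℕ) (q : 𝒬) : 0 ≤ d s q := QGC.fiberDev_nonneg _ _
  have he₀ (q : 𝒬) : 0 ≤ e₀ q := QGC.fiberEntropy_nonneg _ _
  have hd₀ (q : 𝒬) : 0 ≤ d₀ q := QGC.fiberDev_nonneg _ _
  have hh (s : ℕ) : 0 ≤ h s := QGC.fiberEntropy_nonneg _ _
  have hdX (s : ℕ) : 0 ≤ dX s := QGC.fiberDev_nonneg _ _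
  have hPQ0 (q : 𝒬) : 0 < (PQ q).toReal := QGC.toReal_pos_of_ne (hPQ q).ne'
  have hH0 (s : ℕ) : 0 ≤ H s := Finset.sum_nonneg fun q _ => mul_nonneg (hPQ0 q).le (he s q)
  have hHle (s : ℕ) : H s ≤ H₀ := Finset.sum_le_sum fun q _ =>
    mul_le_mul_of_nonneg_left (QGC.fiberEntropy_le_const _ _) (hPQ0 q).le
  have hHeq (s : ℕ) : QGC.condEntropy (QGC.pairLaw PQ PU) (fun t => t.2)
      (fun t => (t.1, QGC.trunc p r s t.2)) = H s :=
    QGC.condEntropy_pairLaw_fiber PQ hPQ PU (QGC.trunc p r s)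
  have hH₀eq : QGC.condEntropy (QGC.pairLaw PQ PU) (fun t => t.2) (fun t => t.1) = H₀ :=
    QGC.condEntropy_pairLaw_const PQ hPQ PU
  have hheq (s : ℕ) : QGC.condEntropy (QGC.pairLaw PX W) (fun t => t.1)
      (fun t => (t.2, QGC.trunc p r s t.1)) = h s := by
    refine QGC.condEntropy_eq_fiberEntropy _ _ _ ?_
    rintro ⟨x, y⟩ ⟨x', y'⟩ hxy
    simp_all
  have hDs (s : ℕ) : 0 ≤ c * ∑ q, (PQ q).toReal * d s q :=
    mul_nonneg hc.le (Finset.sum_nonneg fun q _ => mul_nonneg (hPQ0 q).le (hd s q))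
  have hD₀ : 0 ≤ c * ∑ q, (PQ q).toReal * d₀ q :=
    mul_nonneg hc.le (Finset.sum_nonneg fun q _ => mul_nonneg (hPQ0 q).le (hd₀ q))
  have hDsum : 0 ≤ ∑ s ∈ Finset.range r, (c * ∑ q, (PQ q).toReal * d s q + dX s) :=
    Finset.sum_nonneg fun s _ => add_nonneg (hDs s) (hdX s)
  -- One constant dominating every typicality deviation; the summand 1 makes it positive, so that `D
  -- * ε` gives exponential decay.
  let D : ℝ := 1 + c * ∑ q, (PQ q).toReal * d₀ q +
    ∑ s ∈ Finset.range r, (c * ∑ q, (PQ q).toReal * d s q + dX s)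
  have hDpos : 0 < D := by simp only [D]; linarith
  have hDle (s : ℕ) (hs : s < r) : c * ∑ q, (PQ q).toReal * d s q + dX s ≤ D := by
    have := Finset.single_le_sum (f := fun s => c * ∑ q, (PQ q).toReal * d s q + dX s)
      (fun s _ => add_nonneg (hDs s) (hdX s)) (Finset.mem_range.2 hs)
    simp only [D]
    linarith
  have hD₀le : c * ∑ q, (PQ q).toReal * d₀ q ≤ D := by simp only [D]; linarith
  clear_value D
  -- The slack is negative: `3Dε` separates the two cases and another `3Dε` pays in the collision
  -- case. Each `3Dε` covers deviations of at most `2Dε` and leaves `Dε` for decay.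
  refine ⟨fun ε => -(6 * D) * ε, ?_, ?_⟩
  · have : Filter.Tendsto (fun ε : ℝ => -(6 * D) * ε) (𝓝 0) (𝓝 (-(6 * D) * 0)) :=
      (continuous_const.mul continuous_id).tendsto 0
    rw [mul_zero] at this
    exact this.mono_left nhdsWithin_le_nhds
  intro ε hε δ hδ
  have hed (s : ℕ) (q : 𝒬) : 0 ≤ e s q + ε * d s q := add_nonneg (he s q) (mul_nonneg hε.le (hd s q))
  have hed₀ : 0 ≤ ∑ q, (e₀ q + ε * d₀ q) :=
    Finset.sum_nonneg fun q _ => add_nonneg (he₀ q) (mul_nonneg hε.le (hd₀ q))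
  have hedsum : 0 ≤ ∑ s ∈ Finset.range r, ∑ q, (e s q + ε * d s q) :=
    Finset.sum_nonneg fun s _ => Finset.sum_nonneg fun q _ => hed s q
  -- Everything in the exponents that does not grow with `n`: rounding and the factor 1/2 per block.
  let b : ℝ := Fintype.card 𝒬 + ∑ q, (e₀ q + ε * d₀ q) +
    ∑ s ∈ Finset.range r, ∑ q, (e s q + ε * d s q)
  have hcard0 : (0 : ℝ) ≤ Fintype.card 𝒬 := Nat.cast_nonneg _
  have hb0 : 0 ≤ b := by simp only [b]; linarith
  have hble (s : ℕ) (hs : s < r) : ∑ q, (e s q + ε * d s q) ≤ b := by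
    have := Finset.single_le_sum (f := fun s => ∑ q, (e s q + ε * d s q))
      (fun s _ => Finset.sum_nonneg fun q _ => hed s q) (Finset.mem_range.2 hs)
    simp only [b]
    linarith
  have hb₀le : Fintype.card 𝒬 + ∑ q, (e₀ q + ε * d₀ q) ≤ b := by simp only [b]; linarith
  clear_value b
  let K : ℝ := 2 * (Fintype.card (ZMod (p ^ r)) : ℝ) ^ 3 / ε ^ 2
  have hev1 : ∀ᶠ n : ℕ in Filter.atTop, ∀ q, K + 1 ≤ c * n * (PQ q).toReal := by
    rw [Filter.eventually_all]
    intro q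
    have : Filter.Tendsto (fun n : ℕ => c * n * (PQ q).toReal) Filter.atTop Filter.atTop :=
      (tendsto_natCast_atTop_atTop.const_mul_atTop hc).atTop_mul_const (hPQ0 q)
    exact this.eventually_ge_atTop _
  -- The count `r + 1` allows for at most `r` levels and the diagonal term.
  have hev2 : ∀ᶠ n : ℕ in Filter.atTop,
      ((r + 1 : ℕ) : ℝ) * (2 : ℝ) ^ (2 * b) * ((2 : ℝ) ^ (-(D * ε))) ^ n < δ := by
    have h1 : (2 : ℝ) ^ (-(D * ε)) < 1 :=
      Real.rpow_lt_one_of_one_lt_of_neg (by norm_num) (by have := mul_pos hDpos hε; linarith)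
    have := (tendsto_pow_atTop_nhds_zero_of_lt_one (by positivity) h1).const_mul
      (((r + 1 : ℕ) : ℝ) * (2 : ℝ) ^ (2 * b))
    rw [mul_zero] at this
    exact this.eventually_lt_const hδ
  obtain ⟨N, hN⟩ := Filter.eventually_atTop.1 (hev1.and hev2)
  refine ⟨N, fun n hn k hk u₀ hu₀ Ω _ μ _ G B Y hGB hY => ?_⟩
  obtain ⟨hnK, hnδ⟩ := hN n hn.le
  refine lt_of_le_of_lt ?_ hnδ
  have hn0 : (0 : ℝ) < n := by exact_mod_cast (Nat.zero_le N).trans_lt hn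
  have hrhs : ((r + 1 : ℕ) : ℝ) * (2 : ℝ) ^ (2 * b) * ((2 : ℝ) ^ (-(D * ε))) ^ n =
      ((r + 1 : ℕ) : ℝ) * (2 : ℝ) ^ (2 * b - n * (D * ε)) := by
    rw [← Real.rpow_natCast, ← Real.rpow_mul (by norm_num), mul_assoc,
      ← Real.rpow_add (by norm_num)]
    congr 2
    ring
  rw [hrhs]
  simp only [hHeq, hH₀eq, hheq]
  let A : Finset ℕ := (Finset.range r).filter fun s => H s ≠ 0
  have hAr {s : ℕ} (hs : s ∈ A) : s < r := Finset.mem_range.1 (Finset.mem_filter.1 hs).1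
  have hApos {s : ℕ} (hs : s ∈ A) : 0 < H s := (hH0 s).lt_of_ne' (Finset.mem_filter.1 hs).2
  have hAcard : (A.card : ℝ) ≤ r := by
    have := Finset.card_filter_le (Finset.range r) fun s => H s ≠ 0
    rw [Finset.card_range] at this
    exact_mod_cast this
  have hA : ∀ u ∈ QGC.indexSet PU ε k, ∀ v ∈ QGC.indexSet PU ε k, u ≠ v → ∃ s ∈ A, s < r ∧
      (∀ i, QGC.trunc p r s (u i) = QGC.trunc p r s (v i)) ∧
      ∃ j, ¬ (p : ZMod (p ^ r)) ^ (s + 1) ∣ (u - v) j := by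
    intro u hu v hv huv
    obtain ⟨s, hs, hlow, hhigh⟩ := QGC.exists_level huv
    refine ⟨s, Finset.mem_filter.2 ⟨Finset.mem_range.2 hs, fun h0 => huv ?_⟩, hs, hlow, hhigh⟩
    refine QGC.eq_of_mem_indexSet (g := QGC.trunc p r s) (fun q => ?_) hu hv hlow
    have := (Finset.sum_eq_zero_iff_of_nonneg fun q _ => mul_nonneg (hPQ0 q).le (he s q)).1 h0 q
      (Finset.mem_univ q)
    exact (mul_eq_zero.1 this).resolve_left (hPQ0 q).ne'
  have hT (s : ℕ) (hs : s < r) : ∑ q, (k q : ℝ) * (e s q + ε * d s q) ≤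
      n * (c * H s + ε * (c * ∑ q, (PQ q).toReal * d s q)) + b :=
    (QGC.sum_blockLength_mul_le (he s) (hd s) hε.le hk).trans (by linarith [hble s hs])
  -- If all levels leave room, the rate condition is dropped and the union bound suffices; otherwise
  -- the competitor is dropped and the code is shown to be unlikely to be so small.
  by_cases hcase : ∀ s ∈ A, c * H s ≤ a s - h s - 3 * (D * ε)
  · refine le_trans (MeasureTheory.measureReal_mono (fun ω hω => hω.2)
      (MeasureTheory.measure_ne_top _ _)) ?_
    refine (QGC.real_exists_typical_le (QGC.pairLaw PX W) hε.le hGB hY hu₀ A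
      fun u hu hne => hA u hu u₀ hu₀ hne).trans ?_
    calc _ ≤ ∑ s ∈ A, (2 : ℝ) ^ (2 * b - n * (D * ε)) := by
          refine Finset.sum_le_sum fun s hs => ?_
          rw [QGC.inv_pow_pow_eq_rpow hp, ← Real.rpow_add (by norm_num),
            ← Real.rpow_add (by norm_num)]
          refine Real.rpow_le_rpow_of_exponent_le (by norm_num) ?_
          have h1 := hT s (hAr hs)
          have h2 := mul_le_mul_of_nonneg_left (hcase s hs) hn0.le
          have h3 := mul_le_mul_of_nonneg_left
            (mul_le_mul_of_nonneg_left (hDle s (hAr hs)) hε.le) hn0.le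
          have h4 : 0 ≤ n * (D * ε) := by positivity
          change ∑ q, (k q : ℝ) * (e s q + ε * d s q) + (n * (h s + ε * dX s) + -(n * a s)) ≤ _
          linarith
      _ = A.card * (2 : ℝ) ^ (2 * b - n * (D * ε)) := by rw [Finset.sum_const, nsmul_eq_mul]
      _ ≤ _ := by
          refine mul_le_mul_of_nonneg_right ?_ (by positivity)
          push_cast
          linarith
  · push Not at hcase
    obtain ⟨t, htA, ht⟩ := hcase
    let F (s : ℕ) : ℝ := H₀ / H s * (a s - h s - 6 * (D * ε))
    -- The tightest rate bound lies below the bound at every level, as the comparison of exponents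
    -- with both `t` and each `s` requires.
    obtain ⟨t', ht'A, ht'⟩ := Finset.exists_min_image A F ⟨t, htA⟩
    have hkey (s : ℕ) (hs : s ∈ A) := QGC.le_sub_of_le_rateBound (hApos hs) (hHle s) (hApos htA)
      (hHle t) (mul_pos hDpos hε).le (hh s) ht (ht' t htA) (ht' s hs)
    have hne : (QGC.indexSet PU ε k).Nonempty := ⟨u₀, hu₀⟩
    refine le_trans (MeasureTheory.measureReal_mono (s₂ := {ω |
      ((QGC.code PU ε (G ω) (B ω)).ncard : ℝ) ≤ (2 : ℝ) ^ (n * F t')}) ?_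
      (MeasureTheory.measure_ne_top _ _)) ?_
    · intro ω hω
      have h1 := hω.1 t' (hAr ht'A) (hApos ht'A).ne'
      have hpos : (0 : ℝ) < (QGC.code PU ε (G ω) (B ω)).ncard := by
        exact_mod_cast (Set.ncard_pos (Set.toFinite _)).2 (hne.image _)
      have h2 : QGC.rate (QGC.code PU ε (G ω) (B ω)) < F t' := by
        refine h1.trans_eq ?_
        simp only [F, a]
        ring
      rw [QGC.rate, div_lt_iff₀ hn0, mul_comm, Real.logb_lt_iff_lt_rpow (by norm_num) hpos] at h2
      exact h2.le
    refine (QGC.real_ncard_code_le hε.le hGB A hA (by positivity) hne).trans ?_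
    have hcardU := QGC.le_card_indexSet PU hε k fun q => by
      have h1 := (abs_lt.1 (hk q)).1
      have h2 := hnK q
      have h3 : K < k q := by linarith
      have h4 : 0 ≤ K := by positivity
      exact ⟨by exact_mod_cast h4.trans_lt h3, h3.le⟩
    have hlow : n * (c * H₀ - ε * D) - b ≤
        -(Fintype.card 𝒬 : ℝ) + ∑ q, k q * (e₀ q - ε * d₀ q) := by
      have h1 := QGC.le_sum_blockLength_mul he₀ hd₀ hε.le hk
      have h3 := mul_le_mul_of_nonneg_left (mul_le_mul_of_nonneg_left hD₀le hε.le) hn0.le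
      change n * (c * H₀ - ε * (c * ∑ q, (PQ q).toReal * d₀ q)) - _ ≤ _ at h1
      linarith
    have hU := (Real.rpow_le_rpow_of_exponent_le (by norm_num) hlow).trans hcardU
    calc _ ≤ (2 : ℝ) ^ (n * F t') / (2 : ℝ) ^ (n * (c * H₀ - ε * D) - b) *
          (1 + ∑ s ∈ A, (2 : ℝ) ^ (n * (c * H s + ε * D) + b - n * a s)) := by
          refine mul_le_mul (div_le_div_of_nonneg_left (by positivity) (by positivity) hU) ?_
            (by positivity) (by positivity)
          refine add_le_add_right (Finset.sum_le_sum fun s hs => ?_) _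
          rw [QGC.inv_pow_pow_eq_rpow hp, ← Real.rpow_add (by norm_num)]
          refine Real.rpow_le_rpow_of_exponent_le (by norm_num) ?_
          have h1 := hT s (hAr hs)
          have h2 : c * ∑ q, (PQ q).toReal * d s q ≤ D := by linarith [hDle s (hAr hs), hdX s]
          have h3 := mul_le_mul_of_nonneg_left (mul_le_mul_of_nonneg_left h2 hε.le) hn0.le
          change ∑ q, (k q : ℝ) * (e s q + ε * d s q) + -(n * a s) ≤ _
          linarith
      _ = (2 : ℝ) ^ (n * F t' - (n * (c * H₀ - ε * D) - b)) +
          ∑ s ∈ A, (2 : ℝ) ^ (n * F t' - (n * (c * H₀ - ε * D) - b) +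
            (n * (c * H s + ε * D) + b - n * a s)) := by
          rw [← Real.rpow_sub (by norm_num), mul_add, mul_one, Finset.mul_sum A]
          congr 1
          exact Finset.sum_congr rfl fun s _ => (Real.rpow_add zero_lt_two _ _).symm
      _ ≤ (2 : ℝ) ^ (2 * b - n * (D * ε)) + ∑ s ∈ A, (2 : ℝ) ^ (2 * b - n * (D * ε)) := by
          have h4 : 0 ≤ n * (D * ε) := by positivity
          refine add_le_add ?_ (Finset.sum_le_sum fun s hs => ?_)
          · refine Real.rpow_le_rpow_of_exponent_le (by norm_num) ?_
            have := mul_le_mul_of_nonneg_left (hkey t htA).1 hn0.le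
            linarith
          · refine Real.rpow_le_rpow_of_exponent_le (by norm_num) ?_
            have := mul_le_mul_of_nonneg_left (hkey s hs).2 hn0.le
            linarith
      _ = (A.card + 1) * (2 : ℝ) ^ (2 * b - n * (D * ε)) := by
          rw [Finset.sum_const, nsmul_eq_mul]
          ring
      _ ≤ _ := by
          refine mul_le_mul_of_nonneg_right ?_ (by positivity)
          push_cast
          linarith
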